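/- Let $\ell,T>0$, $D=(0,\ell)\times(0,T)$, let $J\ge 1$, $u^1<\dots<u^J$ be real numbers and $\gamma_1,\dots,\gamma_J>0$. Let $\alpha,k:\mathbb R\to\mathbb R$ be positive and $C^1$ on each of the segments $(-\infty,u^1]$, $[u^j,u^{j+1}]$ ($1\le j<J$), $[u^J,\infty)$ (with one-sided limits as values at the end points, so that jumps at the $u^j$ are allowed). Put $F(y)=\int_{u^1}^{y}k(s)\,ds$ and assume $F(y)\to\pm\infty$ as $y\to\pm\infty$. Put $v^j=F(u^j)$ and $\beta=(\alpha\circ F^{-1})/(k\circ F^{-1})$, and let $b:\mathbb R\to\mathbb R$ satisfy $b'(v)=\beta(v)$ for $v\notin\{v^1,\dots,v^J\}$ and $b(v^j)^+-b(v^j)^-=\gamma_j$ for all $j$, where $b(v^j)^\pm$ are the one-sided limits. Let $f\in L_\infty(D)$, $p,g\in W_2^1(0,T)$, and $\Phi\in W_2^1(0,\ell)$ with $|\{x\in(0,\ell):\Phi(x)=v^j\}|=0$ for all $j$. A measurable function $B(x,t,v)$ is of type $\mathcal B$ if $B(x,t,v)=b(v)$ when $v\ne v^j$ for all $j$, and $B(x,t,v^j)\in[b(v^j)^-,b(v^j)^+]$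 for all $j$. Here $W_2^{1,1}(D)$ is the space of $\psi\in L_2(D)$ with weak derivatives $\psi_x,\psi_t\in L_2(D)$, and $W_2^{2,1}(D)$ the space of those $\psi\in W_2^{1,1}(D)$ with $\psi_{xx}\in L_2(D)$; boundary values are traces. A function $v\in W_2^{1,1}(D)\cap L_\infty(D)$ is a *weak solution* if for any two functions $B,B_0$ of type $\mathcal B$ $$\int_0^T\!\!\int_0^\ell\big[-B(x,t,v)\psi_t+v_x\psi_x-f\psi\big]\,dx\,dt-\int_0^\ell B_0(x,0,\Phi(x))\psi(x,0)\,dx-\int_0^Tp(t)\psi(\ell,t)\,dt+\int_0^Tg(t)\psi(0,t)\,dt=0\tag{1}$$ for all $\psi\in W_2^{1,1}(D)$ with $\psi(x,T)=0$. A function $v\in L_\infty(D)$ is a *very weak solution* if for any two functions $B,B_0$ of type $\mathcal B$ $$\int_0^T\!\!\int_0^\ell\big[B(x,t,v)\psi_t+v\psi_{xx}+f\psi\big]\,dx\,dt+\int_0^\ell B_0(x,0,\Phi(x))\psi(x,0)\,dx+\int_0^Tp(t)\psi(\ell,t)\,dt-\int_0^Tg(t)\psi(0,t)\,dt=0\tag{2}$$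 for all $\psi\in W_2^{2,1}(D)$ with $\psi(x,T)=0$ and $\psi_x(0,t)=\psi_x(\ell,t)=0$. Then any two weak solutions coincide a.e. in $D$; every weak solution is a very weak solution; and any two very weak solutions coincide a.e. in $D$. The same three assertions hold if, in the definitions, the identities (1), (2) are only required for one pair $B,B_0$ of type $\mathcal B$, which may be different for the two solutions compared (in the inclusion, the pair is kept). -/

import Mathlib

open MeasureTheory Set Filter Topology
open scoped ContDiff

/-! Points of the plane are written `p = (x, t)`: `p.1` is space, `p.2` is time. -/

noncomputable section

namespace Stefan

/-- `a` is of class `C¹` and positive on the closed interval `I`, its values at the end points being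
understood as one-sided limits: on the interior of `I` it coincides with a function that is `C¹` and
positive on all of `I`. -/
def IsPosC1On (a : ℝ → ℝ) (I : Set ℝ) : Prop :=
  ∃ a' : ℝ → ℝ, ContDiffOn ℝ 1 a' I ∧ (∀ y ∈ I, 0 < a' y) ∧ ∀ y ∈ interior I, a y = a' y

/-- `a` is positive and `C¹` on each of the segments `(-∞, u⁰]`, `[uʲ, uʲ⁺¹]`, `[uᴺ, ∞)`. -/
structure IsPiecewisePosC1 {N : ℕ} (u : Fin (N + 1) → ℝ) (a : ℝ → ℝ) : Prop where
  left : IsPosC1On a (Iic (u 0))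
  middle : ∀ j : Fin N, IsPosC1On a (Icc (u j.castSucc) (u j.succ))
  right : IsPosC1On a (Ici (u (Fin.last N)))

/-- `h` belongs to `L₂(c, d)` and has a weak derivative in `L₂(c, d)`. -/
def MemW12 (c d : ℝ) (h : ℝ → ℝ) : Prop :=
  MemLp h 2 (volume.restrict (Ioo c d)) ∧
  ∃ h' : ℝ → ℝ, MemLp h' 2 (volume.restrict (Ioo c d)) ∧
    ∀ φ : ℝ → ℝ, ContDiff ℝ ∞ φ → HasCompactSupport φ → tsupport φ ⊆ Ioo c d →
      ∫ s in Ioo c d, h s * deriv φ s = - ∫ s in Ioo c d, h' s * φ s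

/-- The data of the multiphase Stefan problem with `N + 1` phase transition temperatures. -/
structure Data (N : ℕ) where
  /-- length of the space interval -/
  l : ℝ
  /-- final time -/
  T : ℝ
  /-- phase transition temperatures -/
  u : Fin (N + 1) → ℝ
  /-- heat capacity -/
  α : ℝ → ℝ
  /-- heat conductivity -/
  k : ℝ → ℝ
  /-- coefficients of the Stefan conditions -/
  γ : Fin (N + 1) → ℝ
  /-- primitive of `β` with jumps `γ` -/
  b : ℝ → ℝ
  /-- density of sources -/
  f : ℝ × ℝ → ℝ
  /-- flux on `x = 0` -/
  g : ℝ → ℝ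
  /-- flux on `x = l` -/
  p : ℝ → ℝ
  /-- transformed initial temperature -/
  Φ : ℝ → ℝ

namespace Data

variable {N : ℕ} (S : Data N)

/-- The rectangle `(0, l) × (0, T)`. -/
def D : Set (ℝ × ℝ) := Ioo 0 S.l ×ˢ Ioo 0 S.T

/-- Lebesgue measure on the rectangle. -/
def μ : Measure (ℝ × ℝ) := volume.restrict S.D

/-- The transformation `F(y) = ∫_{u⁰}^y k`. -/
def F (y : ℝ) : ℝ := ∫ s in (S.u 0)..y, S.k s

/-- The transformed critical values `vʲ = F(uʲ)`. -/
def vcrit (j : Fin (N + 1)) : ℝ := S.F (S.u j)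

/-- `β = (α ∘ F⁻¹) / (k ∘ F⁻¹)`. -/
def β (v : ℝ) : ℝ := S.α (Function.invFun S.F v) / S.k (Function.invFun S.F v)

/-- `b' = β` away from the critical values, and `b` has a jump of size `γʲ` at `vʲ`. -/
def IsEnthalpy : Prop :=
  (∀ v : ℝ, (∀ j, v ≠ S.vcrit j) → HasDerivAt S.b (S.β v) v) ∧
  ∀ j, ∃ bl br : ℝ, Tendsto S.b (𝓝[<] S.vcrit j) (𝓝 bl) ∧
    Tendsto S.b (𝓝[>] S.vcrit j) (𝓝 br) ∧ br - bl = S.γ j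

/-- The standing assumptions on the data. The two limits of `F` say that `F` maps `ℝ` onto `ℝ`, so
that `β` and `b` live on all of `ℝ`. -/
structure Admissible : Prop where
  l_pos : 0 < S.l
  T_pos : 0 < S.T
  u_strictMono : StrictMono S.u
  α_pw : IsPiecewisePosC1 S.u S.α
  k_pw : IsPiecewisePosC1 S.u S.k
  F_atTop : Tendsto S.F atTop atTop
  F_atBot : Tendsto S.F atBot atBot
  γ_pos : ∀ j, 0 < S.γ j
  b_enthalpy : S.IsEnthalpy
  f_mem : MemLp S.f ⊤ S.μ
  g_mem : MemW12 0 S.T S.g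
  p_mem : MemW12 0 S.T S.p
  Φ_mem : MemW12 0 S.l S.Φ
  Φ_null : ∀ j, volume {x | x ∈ Ioo 0 S.l ∧ S.Φ x = S.vcrit j} = 0

/-- Functions `B(x, t, v)` of type `𝓑`. -/
structure IsTypeB (B : ℝ → ℝ → ℝ → ℝ) : Prop where
  measurable : Measurable fun q : ℝ × ℝ × ℝ => B q.1 q.2.1 q.2.2
  eq_b : ∀ x t v, (∀ j, v ≠ S.vcrit j) → B x t v = S.b v
  mem_Icc : ∀ x t j, B x t (S.vcrit j) ∈
    Icc (Function.leftLim S.b (S.vcrit j)) (Function.rightLim S.b (S.vcrit j))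

/-- `w` is the weak derivative of `u` on the rectangle in the direction `e`. -/
def IsWeakDeriv (e : ℝ × ℝ) (u w : ℝ × ℝ → ℝ) : Prop :=
  ∀ φ : ℝ × ℝ → ℝ, ContDiff ℝ ∞ φ → HasCompactSupport φ → tsupport φ ⊆ S.D →
    ∫ q in S.D, u q * fderiv ℝ φ q e = - ∫ q in S.D, w q * φ q

/-- `u ∈ W₂^{1,1}(D)` with weak derivatives `u_x = ux`, `u_t = ut`. -/
structure IsW11 (u ux ut : ℝ × ℝ → ℝ) : Prop where
  mem : MemLp u 2 S.μ
  mem_x : MemLp ux 2 S.μ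
  mem_t : MemLp ut 2 S.μ
  deriv_x : S.IsWeakDeriv (1, 0) u ux
  deriv_t : S.IsWeakDeriv (0, 1) u ut

/-- `u ∈ W₂^{2,1}(D)` with weak derivatives `u_x = ux`, `u_xx = uxx`, `u_t = ut`. -/
structure IsW21 (u ux uxx ut : ℝ × ℝ → ℝ) : Prop extends S.IsW11 u ux ut where
  mem_xx : MemLp uxx 2 S.μ
  deriv_xx : S.IsWeakDeriv (1, 0) ux uxx

/-- `h` is the trace on the side `x = c` (`c = 0` or `c = l`) of a function `u` with weak derivative
`u_x = ux ∈ L₂(D)`: the representative of `u` that is absolutely continuous in `x` on `[0, l]` for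
almost every `t` takes the value `h(t)` at `x = c`. Such an `h` exists and is unique up to null
sets. -/
def IsTraceX (u ux : ℝ × ℝ → ℝ) (c : ℝ) (h : ℝ → ℝ) : Prop :=
  ∀ᵐ q ∂S.μ, u q = h q.2 + ∫ y in c..q.1, ux (y, q.2)

/-- `h` is the trace on the side `t = c` (`c = 0` or `c = T`) of a function `u` with weak derivative
`u_t = ut ∈ L₂(D)`. -/
def IsTraceT (u ut : ℝ × ℝ → ℝ) (c : ℝ) (h : ℝ → ℝ) : Prop :=
  ∀ᵐ q ∂S.μ, u q = h q.1 + ∫ s in c..q.2, ut (q.1, s)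

/-- The weak integral identity for `v` with weak derivative `v_x = vx`, with given `B` and `B₀`. Here
`ψ₀`, `ψl`, `ψr` are the traces of `ψ` on `t = 0`, `x = 0`, `x = l`. -/
def WeakIdentity (B B₀ : ℝ → ℝ → ℝ → ℝ) (v vx : ℝ × ℝ → ℝ) : Prop :=
  ∀ (ψ ψx ψt : ℝ × ℝ → ℝ) (ψ₀ ψl ψr : ℝ → ℝ), S.IsW11 ψ ψx ψt →
    S.IsTraceT ψ ψt S.T (fun _ => 0) → S.IsTraceT ψ ψt 0 ψ₀ →
    S.IsTraceX ψ ψx 0 ψl → S.IsTraceX ψ ψx S.l ψr →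
    (∫ q in S.D, (-(B q.1 q.2 (v q)) * ψt q + vx q * ψx q - S.f q * ψ q))
      - (∫ x in Ioo 0 S.l, B₀ x 0 (S.Φ x) * ψ₀ x)
      - (∫ t in Ioo 0 S.T, S.p t * ψr t) + (∫ t in Ioo 0 S.T, S.g t * ψl t) = 0

/-- The very weak integral identity for `v`, with given `B` and `B₀`. -/
def VeryWeakIdentity (B B₀ : ℝ → ℝ → ℝ → ℝ) (v : ℝ × ℝ → ℝ) : Prop :=
  ∀ (ψ ψx ψxx ψt : ℝ × ℝ → ℝ) (ψ₀ ψl ψr : ℝ → ℝ), S.IsW21 ψ ψx ψxx ψt →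
    S.IsTraceT ψ ψt S.T (fun _ => 0) →
    S.IsTraceX ψx ψxx 0 (fun _ => 0) → S.IsTraceX ψx ψxx S.l (fun _ => 0) →
    S.IsTraceT ψ ψt 0 ψ₀ → S.IsTraceX ψ ψx 0 ψl → S.IsTraceX ψ ψx S.l ψr →
    (∫ q in S.D, (B q.1 q.2 (v q) * ψt q + v q * ψxx q + S.f q * ψ q))
      + (∫ x in Ioo 0 S.l, B₀ x 0 (S.Φ x) * ψ₀ x)
      + (∫ t in Ioo 0 S.T, S.p t * ψr t) - (∫ t in Ioo 0 S.T, S.g t * ψl t) = 0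

/-- `v ∈ W₂^{1,1}(D) ∩ L_∞(D)` satisfies the weak identity with the pair `B`, `B₀`. -/
def IsWeakSolutionWith (B B₀ : ℝ → ℝ → ℝ → ℝ) (v : ℝ × ℝ → ℝ) : Prop :=
  MemLp v ⊤ S.μ ∧ ∃ vx vt, S.IsW11 v vx vt ∧ S.WeakIdentity B B₀ v vx

/-- `v ∈ L_∞(D)` satisfies the very weak identity with the pair `B`, `B₀`. -/
def IsVeryWeakSolutionWith (B B₀ : ℝ → ℝ → ℝ → ℝ) (v : ℝ × ℝ → ℝ) : Prop :=
  MemLp v ⊤ S.μ ∧ S.VeryWeakIdentity B B₀ v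

/-- Weak solution: the weak identity holds for any two functions `B`, `B₀` of type `𝓑`. -/
def IsWeakSolution (v : ℝ × ℝ → ℝ) : Prop :=
  MemLp v ⊤ S.μ ∧ ∃ vx vt, S.IsW11 v vx vt ∧
    ∀ B B₀, S.IsTypeB B → S.IsTypeB B₀ → S.WeakIdentity B B₀ v vx

/-- Very weak solution: the very weak identity holds for any two functions `B`, `B₀` of type `𝓑`. -/
def IsVeryWeakSolution (v : ℝ × ℝ → ℝ) : Prop :=
  MemLp v ⊤ S.μ ∧ ∀ B B₀, S.IsTypeB B → S.IsTypeB B₀ → S.VeryWeakIdentity B B₀ v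

end Data

end Stefan

end

/-! Everything rests on uniqueness of very weak solutions. Let `v`, `w` satisfy (2) with pairs `B,
B₀` and `B', B₀'`, and put `z = B(v) - B'(w)`, `e = v - w`. In the difference of the two identities
the source and boundary terms cancel, and so do the initial terms, because `Φ` avoids the critical
values almost everywhere. What remains is `∫∫ (z ψ_t + e ψ_xx) = 0`.

Take `ψ = cos(κx) θ(t)` with `κ = nπ/l`, `θ(T) = 0`, and let `z_n`, `e_n` be the cosine coefficients
in `x`. Then `∫ z_n θ' = κ² ∫ e_n θ`. The choice `θ' = e_n` turns the right side into `κ² ∫ θ' θ =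
-κ² θ(0)² / 2 ≤ 0`. Summing over `n` by Parseval gives `∫∫ z e ≤ 0` (`integral_mul_nonpos`), so no
dual parabolic problem has to be solved.

On the other hand any two functions of type `𝓑` are strictly ordered along `v < w`
(`IsTypeB.lt_of_lt`), so `z e ≥ 0`, with equality only where `v = w`. Hence `v = w` almost
everywhere (`VeryWeakIdentity.ae_eq`).

A weak solution is very weak by integrating `v_x ψ_x` by parts in `x`, where `ψ_x` has zero traces
(`integral_mul_add_mul_eq_zero`). This needs `v` to be absolutely continuous on almost every line,
which comes from the lemma of du Bois-Reymond. Uniqueness of weak solutions follows from the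
inclusion. -/

namespace Stefan

/-! ### Integration by parts for primitives, and Parseval's identity for cosine series -/

/-- Product rule for absolutely continuous functions. As `p` and `q` are merely integrable, the
primitives are differentiable only almost everywhere. -/
theorem integral_mul_primitive_add {a b : ℝ} {p q : ℝ → ℝ} (hp : IntervalIntegrable p volume a b)
    (hq : IntervalIntegrable q volume a b) (C D : ℝ) :
    ∫ x in a..b, (p x * (D + ∫ y in a..x, q y) + (C + ∫ y in a..x, p y) * q x) =
      (C + ∫ y in a..b, p y) * (D + ∫ y in a..b, q y) - C * D := by
  have hac : ∀ (E : ℝ) {r : ℝ → ℝ}, IntervalIntegrable r volume a b →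
      AbsolutelyContinuousOnInterval (fun x => E + ∫ y in a..x, r y) a b := fun E r hr =>
    ((LipschitzWith.const E).lipschitzOnWith (s := uIcc a b)).absolutelyContinuousOnInterval.fun_add
      (hr.absolutelyContinuousOnInterval_intervalIntegral left_mem_uIcc)
  have h := (hac C hp).integral_deriv_mul_eq_sub (hac D hq)
  simp only [intervalIntegral.integral_same, add_zero] at h
  rw [← h]
  refine intervalIntegral.integral_congr_ae ?_
  filter_upwards [hp.ae_hasDerivAt_integral, hq.ae_hasDerivAt_integral] with x hxp hxq hx
  have hx' := uIoc_subset_uIcc hx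
  rw [((hxp hx' a left_mem_uIcc).const_add C).deriv, ((hxq hx' a left_mem_uIcc).const_add D).deriv]

/-- Unnormalized cosine coefficients of a function on `(0, l)`. -/
noncomputable def cosCoeff (l : ℝ) (n : ℤ) (a : ℝ → ℝ) : ℝ :=
  ∫ x in (0 : ℝ)..l, a x * Real.cos (n * Real.pi / l * x)

/-- The even extension `a |x|` to `(-l, l)` has a pure cosine series: reflecting the half over `(-l,
0)` pairs the two exponentials into `2 cos`, and this `2` meets the normalization `1 / (2l)`. -/
theorem fourierCoeffOn_comp_abs {l : ℝ} (hl : 0 < l) {a : ℝ → ℝ} (ha : Measurable a) {C : ℝ}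
    (hC : ∀ x, |a x| ≤ C) (n : ℤ) :
    fourierCoeffOn (neg_lt_self hl) (fun x => (a |x| : ℂ)) n = ((cosCoeff l n a / l : ℝ) : ℂ) := by
  have hm : Measurable fun x : ℝ => (a |x| : ℂ) :=
    Complex.measurable_ofReal.comp (ha.comp continuous_abs.measurable)
  set c : ℂ := Real.pi * Complex.I * n / l with hc
  have hF : ∀ x : ℝ, fourier (-n) (x : AddCircle (l - -l)) = Complex.exp (-c * x) := by
    intro x
    rw [fourier_coe_apply]
    congr 1
    have : (l : ℂ) ≠ 0 := by exact_mod_cast hl.ne'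
    push_cast
    rw [hc]
    field_simp
    ring
  have hint : ∀ (s : ℂ) (y z : ℝ), IntervalIntegrable
      (fun x : ℝ => Complex.exp (s * x) * (a |x| : ℂ)) volume y z := by
    intro s y z
    refine IntervalIntegrable.continuousOn_mul (f := fun x : ℝ => (a |x| : ℂ)) ?_ (by fun_prop)
    refine (intervalIntegrable_const (c := C)).mono_fun hm.aestronglyMeasurable ?_
    filter_upwards with x
    rw [Complex.norm_real, Real.norm_eq_abs, Real.norm_eq_abs]
    exact (hC _).trans (le_abs_self C)
  rw [fourierCoeffOn_eq_integral]
  simp only [hF, smul_eq_mul]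
  rw [← intervalIntegral.integral_add_adjacent_intervals (hint _ (-l) 0) (hint _ 0 l)]
  have h1 : ∫ x in (-l)..0, Complex.exp (-c * x) * (a |x| : ℂ)
      = ∫ x in (0 : ℝ)..l, Complex.exp (c * x) * (a |x| : ℂ) := by
    have := intervalIntegral.integral_comp_neg (a := 0) (b := l)
      (fun x : ℝ => Complex.exp (-c * x) * (a |x| : ℂ))
    rw [neg_zero] at this
    rw [← this]
    simp
  rw [h1, ← intervalIntegral.integral_add (hint _ 0 l) (hint _ 0 l)]
  have h2 : ∫ x in (0 : ℝ)..l, (Complex.exp (c * x) * (a |x| : ℂ) + Complex.exp (-c * x) * (a |x| : ℂ))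
      = ∫ x in (0 : ℝ)..l, (((2 * (a x * Real.cos (n * Real.pi / l * x)) : ℝ)) : ℂ) := by
    refine intervalIntegral.integral_congr fun x hx => ?_
    rw [uIcc_of_le hl.le] at hx
    simp only [abs_of_nonneg hx.1]
    push_cast
    rw [Complex.cos]
    rw [show c * x = n * Real.pi / l * x * Complex.I by rw [hc]; ring,
      show -c * x = -(n * Real.pi / l * x) * Complex.I by rw [hc]; ring]
    ring
  rw [h2, intervalIntegral.integral_ofReal, intervalIntegral.integral_const_mul]
  rw [cosCoeff, Complex.real_smul]
  push_cast
  have : (l : ℂ) ≠ 0 := by exact_mod_cast hl.ne'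
  field_simp
  ring

/-- Parseval on `(-l, l)` for the even extension. Summing over all integers counts each nonconstant
mode twice, so the constant is `l` for every mode and `n = 0` is not special. -/
theorem hasSum_sq_cosCoeff {l : ℝ} (hl : 0 < l) {a : ℝ → ℝ} (ha : Measurable a) {C : ℝ}
    (hC : ∀ x, |a x| ≤ C) :
    HasSum (fun n : ℤ => cosCoeff l n a ^ 2) (l * ∫ x in (0 : ℝ)..l, a x ^ 2) := by
  have hm : Measurable fun x : ℝ => (a |x| : ℂ) :=
    Complex.measurable_ofReal.comp (ha.comp continuous_abs.measurable)
  have hL : MemLp (fun x : ℝ => (a |x| : ℂ)) 2 (volume.restrict (Ioc (-l) l)) := by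
    refine MemLp.of_bound hm.aestronglyMeasurable C ?_
    filter_upwards with x
    rw [Complex.norm_real, Real.norm_eq_abs]
    exact hC _
  have h := (hasSum_sq_fourierCoeffOn (neg_lt_self hl) hL).mul_left (l ^ 2)
  simp only [fourierCoeffOn_comp_abs hl ha hC, Complex.norm_real, Real.norm_eq_abs, sq_abs,
    smul_eq_mul] at h
  have hint : ∀ y z : ℝ, IntervalIntegrable (fun x : ℝ => a |x| ^ 2) volume y z := by
    intro y z
    refine (intervalIntegrable_const (c := C ^ 2)).mono_fun
      (((ha.comp continuous_abs.measurable).pow_const 2).aestronglyMeasurable) ?_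
    filter_upwards with x
    rw [Real.norm_eq_abs, Real.norm_eq_abs, abs_pow, abs_of_nonneg (sq_nonneg C)]
    exact pow_le_pow_left₀ (abs_nonneg _) (hC _) 2
  have h1 : ∫ x in (-l)..0, a |x| ^ 2 = ∫ x in (0 : ℝ)..l, a |x| ^ 2 := by
    have := intervalIntegral.integral_comp_neg (a := 0) (b := l) (fun x : ℝ => a |x| ^ 2)
    rw [neg_zero] at this
    rw [← this]
    simp
  have h2 : ∫ x in (0 : ℝ)..l, a |x| ^ 2 = ∫ x in (0 : ℝ)..l, a x ^ 2 := by
    refine intervalIntegral.integral_congr fun x hx => ?_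
    rw [uIcc_of_le hl.le] at hx
    simp only [abs_of_nonneg hx.1]
  rw [← intervalIntegral.integral_add_adjacent_intervals (hint (-l) 0) (hint 0 l), h1, h2] at h
  have e1 : (fun n : ℤ => l ^ 2 * (cosCoeff l n a / l) ^ 2) = fun n => cosCoeff l n a ^ 2 := by
    ext n
    field_simp
  have e2 : ∀ I : ℝ, l ^ 2 * ((l - -l)⁻¹ * (I + I)) = l * I := by
    intro I
    rw [sub_neg_eq_add]
    field_simp
  rwa [e1, e2] at h

/-- Polarization of the preceding identity. -/
theorem hasSum_cosCoeff_mul {l : ℝ} (hl : 0 < l) {a b : ℝ → ℝ} (ha : Measurable a)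
    (hb : Measurable b) {C : ℝ} (haC : ∀ x, |a x| ≤ C) (hbC : ∀ x, |b x| ≤ C) :
    HasSum (fun n : ℤ => cosCoeff l n a * cosCoeff l n b) (l * ∫ x in (0 : ℝ)..l, a x * b x) := by
  have hi : ∀ {f : ℝ → ℝ} (K : ℝ), Measurable f → (∀ x, |f x| ≤ K) →
      IntervalIntegrable f volume 0 l := fun K hf hK =>
    (intervalIntegrable_const (c := K)).mono_fun hf.aestronglyMeasurable
      (by filter_upwards with x; exact (hK x).trans (le_abs_self K))
  have hp := hasSum_sq_cosCoeff hl (ha.add hb) (C := C + C)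
    fun x => (abs_add_le _ _).trans (add_le_add (haC x) (hbC x))
  have hsub := hasSum_sq_cosCoeff hl (ha.sub hb) (C := C + C)
    fun x => (abs_sub _ _).trans (add_le_add (haC x) (hbC x))
  have hadd : ∀ n : ℤ, cosCoeff l n (a + b) = cosCoeff l n a + cosCoeff l n b := by
    intro n
    simp only [cosCoeff, Pi.add_apply, add_mul]
    exact intervalIntegral.integral_add ((hi C ha haC).mul_continuousOn (by fun_prop))
      ((hi C hb hbC).mul_continuousOn (by fun_prop))
  have hsb : ∀ n : ℤ, cosCoeff l n (a - b) = cosCoeff l n a - cosCoeff l n b := by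
    intro n
    simp only [cosCoeff, Pi.sub_apply, sub_mul]
    exact intervalIntegral.integral_sub ((hi C ha haC).mul_continuousOn (by fun_prop))
      ((hi C hb hbC).mul_continuousOn (by fun_prop))
  have hsq : ∀ {f : ℝ → ℝ}, Measurable f → (∀ x, |f x| ≤ C + C) →
      IntervalIntegrable (fun x => f x ^ 2) volume 0 l := fun hf hK =>
    hi ((C + C) ^ 2) (hf.pow_const 2) fun x => by
      rw [abs_pow]; exact pow_le_pow_left₀ (abs_nonneg _) (hK x) 2
  have h := (hp.sub hsub).mul_left (1 / 4)
  rw [← mul_sub, ← intervalIntegral.integral_sub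
    (hsq (ha.add hb) fun x => (abs_add_le _ _).trans (add_le_add (haC x) (hbC x)))
    (hsq (ha.sub hb) fun x => (abs_sub _ _).trans (add_le_add (haC x) (hbC x)))] at h
  have e1 : (fun n : ℤ => 1 / 4 * (cosCoeff l n (a + b) ^ 2 - cosCoeff l n (a - b) ^ 2)) =
      fun n => cosCoeff l n a * cosCoeff l n b := by
    ext n
    rw [hadd, hsb]
    ring
  rw [e1, mul_left_comm, ← intervalIntegral.integral_const_mul] at h
  have e2 : ∀ x, 1 / 4 * ((a + b) x ^ 2 - (a - b) x ^ 2) = a x * b x := by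
    intro x
    simp only [Pi.add_apply, Pi.sub_apply]
    ring
  simpa only [e2] using h

theorem measurable_cosCoeff {l : ℝ} {z : ℝ × ℝ → ℝ} (hz : Measurable z) (n : ℤ) (hl : 0 ≤ l) :
    Measurable fun t => cosCoeff l n fun x => z (x, t) := by
  simp only [cosCoeff, intervalIntegral.integral_of_le hl]
  have hf : Measurable fun q : ℝ × ℝ => z q * Real.cos (n * Real.pi / l * q.1) := by fun_prop
  exact (hf.stronglyMeasurable.integral_prod_left' (μ := volume.restrict (Ioc 0 l))).measurable

theorem abs_cosCoeff_le {l : ℝ} (hl : 0 ≤ l) {a : ℝ → ℝ} {C : ℝ} (hC : ∀ x, |a x| ≤ C) (n : ℤ) :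
    |cosCoeff l n a| ≤ C * l := by
  have h := intervalIntegral.norm_integral_le_of_norm_le_const (a := 0) (b := l) (C := C)
    (f := fun x => a x * Real.cos (n * Real.pi / l * x)) fun x _ => by
      rw [Real.norm_eq_abs, abs_mul]
      exact (mul_le_of_le_one_right (abs_nonneg _) (Real.abs_cos_le_one _)).trans (hC x)
  rwa [sub_zero, abs_of_nonneg hl] at h

/-- Parseval in `x` is integrated term by term in `t`. The terms are dominated by half the sum of
the squared coefficients, whose sum over `n` is again given by Parseval. -/
theorem integral_integral_mul_nonpos_of_cosCoeff {l T : ℝ} (hl : 0 < l)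
    {z e : ℝ × ℝ → ℝ} (hz : Measurable z) (he : Measurable e) {C : ℝ} (hzC : ∀ q, |z q| ≤ C)
    (heC : ∀ q, |e q| ≤ C)
    (h : ∀ n : ℤ, ∫ t in (0 : ℝ)..T,
      (cosCoeff l n fun x => z (x, t)) * (cosCoeff l n fun x => e (x, t)) ≤ 0) :
    ∫ t in (0 : ℝ)..T, ∫ x in (0 : ℝ)..l, z (x, t) * e (x, t) ≤ 0 := by
  have hzt : ∀ t, Measurable fun x => z (x, t) := fun t => hz.comp (by fun_prop)
  have het : ∀ t, Measurable fun x => e (x, t) := fun t => he.comp (by fun_prop)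
  have hsum : ∀ t, HasSum (fun n : ℤ => ((cosCoeff l n fun x => z (x, t)) ^ 2 +
      (cosCoeff l n fun x => e (x, t)) ^ 2) / 2)
      ((l * (∫ x in (0 : ℝ)..l, z (x, t) ^ 2) + l * ∫ x in (0 : ℝ)..l, e (x, t) ^ 2) / 2) :=
    fun t => ((hasSum_sq_cosCoeff hl (hzt t) fun x => hzC _).add
      (hasSum_sq_cosCoeff hl (het t) fun x => heC _)).div_const 2
  have hsqi : ∀ {w : ℝ × ℝ → ℝ}, Measurable w → (∀ q, |w q| ≤ C) →
      IntervalIntegrable (fun t => ∫ x in (0 : ℝ)..l, w (x, t) ^ 2) volume 0 T := by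
    intro w hw hwC
    simp only [intervalIntegral.integral_of_le hl.le]
    have hm := ((hw.pow_const 2).stronglyMeasurable.integral_prod_left'
      (μ := volume.restrict (Ioc 0 l)))
    refine (intervalIntegrable_const (c := C ^ 2 * l)).mono_fun hm.aestronglyMeasurable ?_
    filter_upwards with t
    have hb := intervalIntegral.norm_integral_le_of_norm_le_const (a := 0) (b := l) (C := C ^ 2)
      (f := fun x => w (x, t) ^ 2) fun x _ => by
        rw [Real.norm_eq_abs, abs_pow]; exact pow_le_pow_left₀ (abs_nonneg _) (hwC _) 2
    rw [intervalIntegral.integral_of_le hl.le, sub_zero, abs_of_pos hl] at hb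
    exact hb.trans (le_abs_self _)
  have key := intervalIntegral.hasSum_integral_of_dominated_convergence (μ := volume) (a := 0)
    (b := T)
    (F := fun (n : ℤ) t => (cosCoeff l n fun x => z (x, t)) * (cosCoeff l n fun x => e (x, t)))
    (f := fun t => l * ∫ x in (0 : ℝ)..l, z (x, t) * e (x, t))
    (fun n t => ((cosCoeff l n fun x => z (x, t)) ^ 2 + (cosCoeff l n fun x => e (x, t)) ^ 2) / 2)
    (fun n => ((measurable_cosCoeff hz n hl.le).mul
      (measurable_cosCoeff he n hl.le)).aestronglyMeasurable)
    (fun n => by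
      filter_upwards with t _
      rw [Real.norm_eq_abs, abs_mul, ← sq_abs (cosCoeff l n fun x => z (x, t)),
        ← sq_abs (cosCoeff l n fun x => e (x, t))]
      linarith [two_mul_le_add_sq |cosCoeff l n fun x => z (x, t)| |cosCoeff l n fun x => e (x, t)|])
    (by filter_upwards with t _ using (hsum t).summable)
    (by
      simp only [fun t => (hsum t).tsum_eq]
      exact (((hsqi hz hzC).const_mul l).add ((hsqi he heC).const_mul l)).div_const 2)
    (by filter_upwards with t _ using
          hasSum_cosCoeff_mul hl (hzt t) (het t) (fun x => hzC _) fun x => heC _)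
  have hle := hasSum_le h key hasSum_zero
  rw [intervalIntegral.integral_const_mul] at hle
  exact nonpos_of_mul_nonpos_right hle hl

/-! ### Piecewise coefficients and strict monotonicity of the enthalpy -/

/-- Continuity is not assumed, so upward jumps are allowed. The weak inequality is proved by
continuous induction along `[a, b]`: `hl` makes the set of good points closed, `hr` lets it extend
to the right. -/
theorem strictMono_of_eventually_lt {g : ℝ → ℝ} (hl : ∀ x, ∀ᶠ y in 𝓝[<] x, g y < g x)
    (hr : ∀ x, ∀ᶠ y in 𝓝[>] x, g x < g y) : StrictMono g := by
  have hmono : ∀ a b, a ≤ b → g a ≤ g b := by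
    intro a b hab
    have hsub : Icc a b ⊆ {x | ∀ y ∈ Icc a x, g a ≤ g y} := by
      refine IsClosed.Icc_subset_of_forall_exists_gt ?_ ?_ ?_
      · have : {x | ∀ y ∈ Icc a x, g a ≤ g y} ∩ Icc a b
            = {x | ∀ y ∈ Ico a x, g a ≤ g y} ∩ Icc a b := by
          ext x
          simp only [mem_inter_iff, mem_ofPred_eq, and_congr_left_iff]
          refine fun hx => ⟨fun h y hy => h y ⟨hy.1, hy.2.le⟩, fun h y hy => ?_⟩
          rcases hy.2.lt_or_eq with h1 | rfl
          · exact h y ⟨hy.1, h1⟩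
          · rcases hy.1.lt_or_eq with h2 | rfl
            · obtain ⟨s, hs, hs'⟩ := ((hl y).and (Ioo_mem_nhdsLT h2)).exists
              exact (h s ⟨hs'.1.le, hs'.2⟩).trans hs.le
            · rfl
        rw [this]
        refine IsClosed.inter ?_ isClosed_Icc
        -- With the half-open interval, being good means lying to the left of every point `y ≥ a`
        -- where `g` drops below `g a`.
        have h2 : {x | ∀ y ∈ Ico a x, g a ≤ g y} = ⋂ y ∈ {y | a ≤ y ∧ g y < g a}, Iic y := by
          ext x
          simp only [mem_ofPred_eq, mem_iInter, mem_Iic, mem_Ico, and_imp]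
          exact ⟨fun h y h1 h2 => not_lt.1 fun h3 => (h y h1 h3).not_gt h2,
            fun h y h1 h2 => not_lt.1 fun h3 => (h y h1 h3).not_gt h2⟩
        rw [h2]
        exact isClosed_biInter fun _ _ => isClosed_Iic
      · rintro y ⟨h1, h2⟩
        rw [le_antisymm h2 h1]
      · rintro x ⟨hx, hxab⟩ y hy
        obtain ⟨u, hu, hu'⟩ := mem_nhdsGT_iff_exists_Ioo_subset.1 (hr x)
        have hxu : x < min y ((x + u) / 2) := lt_min hy (by rw [mem_Ioi] at hu; linarith)
        refine ⟨min y ((x + u) / 2), fun s hs => ?_, hxu, min_le_left _ _⟩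
        rcases le_or_gt s x with h1 | h1
        · exact hx s ⟨hs.1, h1⟩
        · have h3 : g x < g s := hu' ⟨h1, hs.2.trans_lt ((min_le_right _ _).trans_lt (by
            rw [mem_Ioi] at hu; linarith))⟩
          exact (hx x ⟨hxab.1, le_rfl⟩).trans h3.le
    exact hsub (right_mem_Icc.2 hab) b (right_mem_Icc.2 hab)
  intro a b hab
  obtain ⟨s, hs, hs'⟩ := ((hr a).and (Ioo_mem_nhdsGT hab)).exists
  exact hs.trans_le (hmono s b hs'.2.le)

theorem exists_segment {N : ℕ} (u : Fin (N + 1) → ℝ) (y : ℝ) :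
    y ≤ u 0 ∨ (∃ j : Fin N, y ∈ Icc (u j.castSucc) (u j.succ)) ∨ u (Fin.last N) ≤ y := by
  have h : ∀ i : Fin (N + 1), y ≤ u i →
      y ≤ u 0 ∨ ∃ j : Fin N, y ∈ Icc (u j.castSucc) (u j.succ) := by
    intro i
    induction i using Fin.induction with
    | zero => exact Or.inl
    | succ j ih =>
      intro hj
      rcases le_total y (u j.castSucc) with h1 | h1
      · exact ih h1
      · exact Or.inr ⟨j, h1, hj⟩
  rcases le_total y (u (Fin.last N)) with h1 | h1
  · rcases h _ h1 with h2 | h2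
    · exact Or.inl h2
    · exact Or.inr (Or.inl h2)
  · exact Or.inr (Or.inr h1)

/-- `a` may differ from its `C¹` model only on the frontier, which is null for a convex set. -/
theorem IsPosC1On.integrableOn {a : ℝ → ℝ} {I : Set ℝ} (h : IsPosC1On a I) (hI : Convex ℝ I)
    (hIc : IsClosed I) (c d : ℝ) : IntegrableOn a (I ∩ Icc c d) := by
  obtain ⟨a', ha', -, heq⟩ := h
  have hi : IntegrableOn a' (I ∩ Icc c d) :=
    (ha'.continuousOn.mono inter_subset_left).integrableOn_compact
      (isCompact_Icc.inter_left hIc)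
  refine hi.congr_fun_ae ?_
  have h0 : ∀ᵐ x, x ∉ frontier I := measure_eq_zero_iff_ae_notMem.1 (hI.addHaar_frontier volume)
  rw [EventuallyEq, ae_restrict_iff' (hIc.inter isClosed_Icc).measurableSet]
  filter_upwards [h0] with x hx hxI
  refine (heq x ?_).symm
  by_contra hcon
  exact hx ⟨subset_closure hxI.1, hcon⟩

namespace IsPiecewisePosC1

variable {N : ℕ} {u : Fin (N + 1) → ℝ} {a : ℝ → ℝ}

theorem pos (h : IsPiecewisePosC1 u a) {y : ℝ} (hy : ∀ j, y ≠ u j) : 0 < a y := by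
  have key : ∀ I : Set ℝ, IsPosC1On a I → y ∈ interior I → 0 < a y := by
    rintro I ⟨a', -, hpos, heq⟩ hyI
    rw [heq y hyI]
    exact hpos y (interior_subset hyI)
  rcases exists_segment u y with h1 | ⟨j, h1⟩ | h1
  · exact key _ h.left (by rw [interior_Iic]; exact lt_of_le_of_ne h1 (hy 0))
  · exact key _ (h.middle j) (by
      rw [interior_Icc]; exact ⟨lt_of_le_of_ne h1.1 (hy _).symm, lt_of_le_of_ne h1.2 (hy _)⟩)
  · exact key _ h.right (by rw [interior_Ici]; exact lt_of_le_of_ne h1 (hy _).symm)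

theorem intervalIntegrable (h : IsPiecewisePosC1 u a) (c d : ℝ) :
    IntervalIntegrable a volume c d := by
  rw [intervalIntegrable_iff']
  have hm : IntegrableOn a (⋃ j : Fin N, (Icc (u j.castSucc) (u j.succ) ∩ uIcc c d)) :=
    integrableOn_finite_iUnion.2 fun j =>
      (h.middle j).integrableOn (convex_Icc _ _) isClosed_Icc _ _
  refine ((h.left.integrableOn (convex_Iic _) isClosed_Iic (min c d) (max c d)).union (hm.union
    (h.right.integrableOn (convex_Ici _) isClosed_Ici (min c d) (max c d)))).mono_set fun y hy => ?_
  rcases exists_segment u y with h1 | ⟨j, h1⟩ | h1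
  · exact Or.inl ⟨h1, hy⟩
  · exact Or.inr (Or.inl (mem_iUnion.2 ⟨j, h1, hy⟩))
  · exact Or.inr (Or.inr ⟨h1, hy⟩)

end IsPiecewisePosC1

namespace Data

variable {N : ℕ} {S : Data N}

theorem Admissible.F_surjective (hS : S.Admissible) : Function.Surjective S.F :=
  (intervalIntegral.continuous_primitive hS.k_pw.intervalIntegrable _).surjective
    hS.F_atTop hS.F_atBot

/-- Surjectivity of `F` makes `Function.invFun S.F` a right inverse, which suffices: `F⁻¹(v) = uʲ`
would force `v = vʲ`. -/
theorem Admissible.β_pos (hS : S.Admissible) {v : ℝ} (hv : ∀ j, v ≠ S.vcrit j) : 0 < S.β v := by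
  have h1 : S.F (Function.invFun S.F v) = v := Function.rightInverse_invFun hS.F_surjective v
  have h2 : ∀ j, Function.invFun S.F v ≠ S.u j := fun j hj => hv j (by rw [vcrit, ← hj, h1])
  exact div_pos (hS.α_pw.pos h2) (hS.k_pw.pos h2)

theorem finite_vcrit (S : Data N) : (range S.vcrit).Finite := finite_range _

theorem isOpen_compl_vcrit (S : Data N) : IsOpen (range S.vcrit)ᶜ :=
  S.finite_vcrit.isClosed.isOpen_compl

theorem notMem_range_vcrit {v : ℝ} : v ∉ range S.vcrit ↔ ∀ j, v ≠ S.vcrit j := by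
  simp [eq_comm]

/-- Near any point, but away from the point itself, there are no critical values. -/
theorem eventually_notMem_vcrit (S : Data N) (v : ℝ) :
    ∀ᶠ w in 𝓝[≠] v, ∀ j, w ≠ S.vcrit j := by
  have h : (range S.vcrit \ {v})ᶜ ∈ 𝓝 v :=
    (S.finite_vcrit.subset sdiff_subset).isClosed.isOpen_compl.mem_nhds (by simp)
  filter_upwards [nhdsWithin_le_nhds h, self_mem_nhdsWithin] with w hw hwv j hj
  exact hw ⟨⟨j, hj.symm⟩, hwv⟩

theorem Admissible.strictMonoOn_b (hS : S.Admissible) {c d : ℝ}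
    (h : ∀ v ∈ Ioo c d, ∀ j, v ≠ S.vcrit j) : StrictMonoOn S.b (Ioo c d) := by
  have hd : ∀ v ∈ Ioo c d, HasDerivAt S.b (S.β v) v := fun v hv => hS.b_enthalpy.1 v (h v hv)
  refine strictMonoOn_of_deriv_pos (convex_Ioo _ _)
    (fun v hv => (hd v hv).continuousAt.continuousWithinAt) fun v hv => ?_
  rw [interior_Ioo] at hv
  rw [(hd v hv).deriv]
  exact hS.β_pos (h v hv)

theorem Admissible.eventually_b_lt_leftLim (hS : S.Admissible) (j : Fin (N + 1)) :
    ∀ᶠ w in 𝓝[<] S.vcrit j, S.b w < Function.leftLim S.b (S.vcrit j) := by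
  obtain ⟨bl, br, hbl, -, -⟩ := hS.b_enthalpy.2 j
  -- As the one-sided limit exists, `Function.leftLim` is this limit and not its default value.
  rw [leftLim_eq_of_tendsto hbl]
  have h := nhdsWithin_mono _ (fun x (hx : x < S.vcrit j) => hx.ne)
    (S.eventually_notMem_vcrit (S.vcrit j))
  obtain ⟨c, hc, hcs⟩ := mem_nhdsLT_iff_exists_Ioo_subset.1 h
  have hmono := hS.strictMonoOn_b fun v hv => hcs hv
  filter_upwards [Ioo_mem_nhdsLT hc] with w hw
  -- The limit only dominates nearby values weakly; an intermediate point `w'` restores strictness.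
  obtain ⟨w', hw'⟩ := exists_between hw.2
  refine (hmono hw ⟨hw.1.trans hw'.1, hw'.2⟩ hw'.1).trans_le (ge_of_tendsto hbl ?_)
  filter_upwards [Ioo_mem_nhdsLT hw'.2] with s hs
  exact (hmono ⟨hw.1.trans hw'.1, hw'.2⟩ ⟨(hw.1.trans hw'.1).trans hs.1, hs.2⟩ hs.1).le

theorem Admissible.eventually_rightLim_lt_b (hS : S.Admissible) (j : Fin (N + 1)) :
    ∀ᶠ w in 𝓝[>] S.vcrit j, Function.rightLim S.b (S.vcrit j) < S.b w := by
  obtain ⟨bl, br, -, hbr, -⟩ := hS.b_enthalpy.2 j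
  rw [rightLim_eq_of_tendsto hbr]
  have h := nhdsWithin_mono _ (fun x (hx : S.vcrit j < x) => hx.ne')
    (S.eventually_notMem_vcrit (S.vcrit j))
  obtain ⟨c, hc, hcs⟩ := mem_nhdsGT_iff_exists_Ioo_subset.1 h
  have hmono := hS.strictMonoOn_b fun v hv => hcs hv
  filter_upwards [Ioo_mem_nhdsGT hc] with w hw
  obtain ⟨w', hw'⟩ := exists_between hw.1
  refine (le_of_tendsto hbr ?_).trans_lt (hmono ⟨hw'.1, hw'.2.trans hw.2⟩ hw hw'.2)
  filter_upwards [Ioo_mem_nhdsGT hw'.1] with s hs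
  exact (hmono ⟨hs.1, hs.2.trans (hw'.2.trans hw.2)⟩ ⟨hw'.1, hw'.2.trans hw.2⟩ hs.2).le

theorem Admissible.leftLim_le_rightLim (hS : S.Admissible) (j : Fin (N + 1)) :
    Function.leftLim S.b (S.vcrit j) ≤ Function.rightLim S.b (S.vcrit j) := by
  obtain ⟨bl, br, hbl, hbr, h⟩ := hS.b_enthalpy.2 j
  rw [leftLim_eq_of_tendsto hbl, rightLim_eq_of_tendsto hbr]
  linarith [hS.γ_pos j]

/-- Off the critical values `b' = β > 0`. At `vʲ` the value of `B` lies between the one-sided limits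
of `b`, and these strictly separate the values of `b` on the two sides. -/
theorem IsTypeB.strictMono (hS : S.Admissible) {B : ℝ → ℝ → ℝ → ℝ} (hB : S.IsTypeB B) (x t : ℝ) :
    StrictMono (B x t) := by
  have hloc : ∀ v, (∀ j, v ≠ S.vcrit j) →
      ∃ c d, v ∈ Ioo c d ∧ ∀ w ∈ Ioo c d, ∀ j, w ≠ S.vcrit j := by
    intro v hv
    obtain ⟨c, d, h1, h2⟩ := mem_nhds_iff_exists_Ioo_subset.1
      (S.isOpen_compl_vcrit.mem_nhds (notMem_range_vcrit.2 hv))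
    exact ⟨c, d, h1, fun w hw => notMem_range_vcrit.1 (h2 hw)⟩
  refine strictMono_of_eventually_lt (fun v => ?_) fun v => ?_
  · by_cases hv : ∀ j, v ≠ S.vcrit j
    · obtain ⟨c, d, hcd, h⟩ := hloc v hv
      filter_upwards [Ioo_mem_nhdsLT hcd.1] with w hw
      have hw' : w ∈ Ioo c d := ⟨hw.1, hw.2.trans hcd.2⟩
      rw [hB.eq_b x t v hv, hB.eq_b x t w (h w hw')]
      exact hS.strictMonoOn_b h hw' hcd hw.2
    · push Not at hv
      obtain ⟨j, rfl⟩ := hv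
      filter_upwards [hS.eventually_b_lt_leftLim j, nhdsWithin_mono _
        (fun x (hx : x < S.vcrit j) => hx.ne) (S.eventually_notMem_vcrit (S.vcrit j))] with w hw hw'
      rw [hB.eq_b x t w hw']
      exact hw.trans_le (hB.mem_Icc x t j).1
  · by_cases hv : ∀ j, v ≠ S.vcrit j
    · obtain ⟨c, d, hcd, h⟩ := hloc v hv
      filter_upwards [Ioo_mem_nhdsGT hcd.2] with w hw
      have hw' : w ∈ Ioo c d := ⟨hcd.1.trans hw.1, hw.2⟩
      rw [hB.eq_b x t v hv, hB.eq_b x t w (h w hw')]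
      exact hS.strictMonoOn_b h hcd hw' hw.1
    · push Not at hv
      obtain ⟨j, rfl⟩ := hv
      filter_upwards [hS.eventually_rightLim_lt_b j, nhdsWithin_mono _
        (fun x (hx : S.vcrit j < x) => hx.ne') (S.eventually_notMem_vcrit (S.vcrit j))]
        with w hw hw'
      rw [hB.eq_b x t w hw']
      exact (hB.mem_Icc x t j).2.trans_lt hw

theorem exists_notMem_vcrit_between (S : Data N) {v w : ℝ} (h : v < w) :
    ∃ c ∈ Ioo v w, ∀ j, c ≠ S.vcrit j := by
  have h1 : ∀ᶠ c in 𝓝[>] v, ∀ j, c ≠ S.vcrit j :=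
    nhdsWithin_mono _ (fun x (hx : v < x) => hx.ne') (S.eventually_notMem_vcrit v)
  obtain ⟨c, hc, hc'⟩ := (h1.and (Ioo_mem_nhdsGT h)).exists
  exact ⟨c, hc', hc⟩

/-- A noncritical `c` between `v` and `w` serves as a common reference, since there both functions
equal `b c`. This is what allows different pairs for the two solutions. -/
theorem IsTypeB.lt_of_lt (hS : S.Admissible) {B B' : ℝ → ℝ → ℝ → ℝ} (hB : S.IsTypeB B)
    (hB' : S.IsTypeB B') {v w : ℝ} (h : v < w) (x t x' t' : ℝ) : B x t v < B' x' t' w := by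
  obtain ⟨c, hc, hc'⟩ := S.exists_notMem_vcrit_between h
  have h1 := hB.strictMono hS x t hc.1
  have h2 := hB'.strictMono hS x' t' hc.2
  rw [hB.eq_b x t c hc'] at h1
  rw [hB'.eq_b x' t' c hc'] at h2
  exact h1.trans h2

theorem IsTypeB.exists_bound (hS : S.Admissible) {B : ℝ → ℝ → ℝ → ℝ} (hB : S.IsTypeB B) (M : ℝ) :
    ∃ C, ∀ x t v, |v| ≤ M → |B x t v| ≤ C := by
  refine ⟨|B 0 0 (-M - 1)| + |B 0 0 (M + 1)|, fun x t v hv => ?_⟩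
  rw [abs_le] at hv ⊢
  have h1 := hB.lt_of_lt hS hB (show -M - 1 < v by linarith) 0 0 x t
  have h2 := hB.lt_of_lt hS hB (show v < M + 1 by linarith) x t 0 0
  constructor
  · linarith [neg_abs_le (B 0 0 (-M - 1)), abs_nonneg (B 0 0 (M + 1))]
  · linarith [le_abs_self (B 0 0 (M + 1)), abs_nonneg (B 0 0 (-M - 1))]

/-- Without such a `B` the definitions that quantify over all pairs would be vacuous. -/
theorem Admissible.exists_isTypeB (hS : S.Admissible) : ∃ B, S.IsTypeB B := by
  classical
  let B : ℝ → ℝ → ℝ → ℝ := fun _ _ =>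
    (range S.vcrit).piecewise (Function.leftLim S.b) S.b
  refine ⟨B, ?_, fun x t v hv => ?_, fun x t j => ?_⟩
  · have hm : Measurable ((range S.vcrit).piecewise (Function.leftLim S.b) S.b) := by
      refine ContinuousOn.measurable_piecewise ?_ (fun v hv =>
        (hS.b_enthalpy.1 v (notMem_range_vcrit.1 hv)).continuousAt.continuousWithinAt)
        S.finite_vcrit.measurableSet
      exact S.finite_vcrit.continuousOn _
    exact hm.comp (by fun_prop)
  · exact piecewise_eq_of_notMem _ _ _ (notMem_range_vcrit.2 hv)
  · have : B x t (S.vcrit j) = Function.leftLim S.b (S.vcrit j) :=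
      piecewise_eq_of_mem _ _ _ (mem_range_self j)
    rw [this]
    exact ⟨le_rfl, hS.leftLim_le_rightLim j⟩

end Data

/-! ### Traces, weak derivatives and the cosine test functions -/

theorem exists_measurable_bounded_ae_eq {X : Type*} [MeasurableSpace X] {μ : Measure X} {f : X → ℝ}
    (hf : MemLp f ⊤ μ) : ∃ (g : X → ℝ) (C : ℝ), Measurable g ∧ (∀ x, |g x| ≤ C) ∧ f =ᵐ[μ] g := by
  obtain ⟨g, hg, hfg⟩ := hf.aestronglyMeasurable
  set M := (eLpNorm f ⊤ μ).toReal
  have hM : 0 ≤ M := ENNReal.toReal_nonneg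
  have hb : ∀ᵐ x ∂μ, |f x| ≤ M := by
    have h := hf.eLpNorm_ne_top
    rw [eLpNorm_exponent_top] at h
    filter_upwards [ae_le_eLpNormEssSup (f := f) (μ := μ)] with x hx
    have h2 := ENNReal.toReal_mono h hx
    rw [toReal_enorm, Real.norm_eq_abs] at h2
    simpa only [M, eLpNorm_exponent_top] using h2
  refine ⟨fun x => max (-M) (min M (g x)), M,
    measurable_const.max (measurable_const.min hg.measurable), fun x => ?_, ?_⟩
  · exact abs_le.2 ⟨le_max_left _ _, max_le (by linarith) (min_le_left _ _)⟩
  · filter_upwards [hfg, hb] with x hx hxb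
    rw [abs_le, hx] at hxb
    rw [hx, min_eq_right hxb.2, max_eq_right hxb.1]

/-- Integration by parts for a function with a prescribed derivative against a primitive that
vanishes at both ends. -/
theorem integral_primitive_mul_of_integral_eq_zero {L c : ℝ} (hL : 0 < L) (hc : c ∈ Icc 0 L)
    {p w : ℝ → ℝ} (hp : IntegrableOn p (Ioo 0 L)) (hw : IntegrableOn w (Ioo 0 L))
    (hp0 : ∫ s in (0 : ℝ)..L, p s = 0) (h : ℝ) :
    ∫ s in Ioo 0 L, ((h + ∫ y in c..s, w y) * p s + w s * ∫ y in (0 : ℝ)..s, p y) = 0 := by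
  have hp' : IntervalIntegrable p volume 0 L :=
    (intervalIntegrable_iff_integrableOn_Ioo_of_le hL.le).2 hp
  have hw' : IntervalIntegrable w volume 0 L :=
    (intervalIntegrable_iff_integrableOn_Ioo_of_le hL.le).2 hw
  -- The constant `h + ∫ y in c..0, w y` moves the base point of the primitive from `c` to `0`.
  have key := integral_mul_primitive_add hw' hp' (h + ∫ y in c..0, w y) 0
  rw [hp0] at key
  rw [← integral_Ioc_eq_integral_Ioo, ← intervalIntegral.integral_of_le hL.le]
  calc _ = ∫ x in (0 : ℝ)..L, (w x * (0 + ∫ y in (0 : ℝ)..x, p y) +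
        ((h + ∫ y in c..0, w y) + ∫ y in (0 : ℝ)..x, w y) * p x) := by
        refine intervalIntegral.integral_congr fun s hs => ?_
        rw [uIcc_of_le hL.le] at hs
        have h0 : (0 : ℝ) ∈ Icc 0 L := ⟨le_rfl, hL.le⟩
        have hsub : ∀ {a b : ℝ}, a ∈ Icc 0 L → b ∈ Icc 0 L → IntervalIntegrable w volume a b :=
          fun ha hb => hw'.mono_set (by
            rw [uIcc_of_le hL.le]; exact (convex_Icc 0 L).ordConnected.uIcc_subset ha hb)
        rw [← intervalIntegral.integral_add_adjacent_intervals (hsub hc h0) (hsub h0 hs)]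
        ring
    _ = 0 := by rw [key]; ring

namespace Data

variable {N : ℕ} {S : Data N}

theorem μ_eq_prod (S : Data N) :
    S.μ = (volume.restrict (Ioo 0 S.l)).prod (volume.restrict (Ioo 0 S.T)) := by
  rw [Measure.prod_restrict]
  rfl

instance (S : Data N) : IsFiniteMeasure S.μ := by
  rw [μ_eq_prod]
  infer_instance

theorem ae_mem_D (S : Data N) : ∀ᵐ q ∂S.μ, q ∈ S.D :=
  ae_restrict_mem (measurableSet_Ioo.prod measurableSet_Ioo)

theorem integrable_mul_of_hasCompactSupport {u φ : ℝ × ℝ → ℝ} (hu : Integrable u S.μ)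
    (hφ : Continuous φ) (hc : HasCompactSupport φ) : Integrable (fun q => u q * φ q) S.μ := by
  obtain ⟨C, hC⟩ := hc.exists_bound_of_continuous hφ
  exact hu.mul_bdd hφ.aestronglyMeasurable (Eventually.of_forall hC)

theorem isWeakDeriv_of_forall_add {e : ℝ × ℝ} {u w : ℝ × ℝ → ℝ} (hu : Integrable u S.μ)
    (hw : Integrable w S.μ)
    (h : ∀ φ : ℝ × ℝ → ℝ, ContDiff ℝ ∞ φ → HasCompactSupport φ → tsupport φ ⊆ S.D →
      ∫ q, (u q * fderiv ℝ φ q e + w q * φ q) ∂S.μ = 0) : S.IsWeakDeriv e u w := by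
  intro φ hφ hc hs
  have h1 := h φ hφ hc hs
  have hcd : Continuous fun q => fderiv ℝ φ q e :=
    (hφ.continuous_fderiv (by simp)).clm_apply continuous_const
  have hcc : HasCompactSupport fun q => fderiv ℝ φ q e := hc.fderiv_apply ℝ e
  rw [integral_add (integrable_mul_of_hasCompactSupport hu hcd hcc)
    (integrable_mul_of_hasCompactSupport hw hφ.continuous hc)] at h1
  exact eq_neg_of_add_eq_zero_left h1

/-- By Fubini the claim reduces to almost every line `t = const`. There `φ` is the primitive of its
own derivative and vanishes at both ends, so the one-dimensional formula applies. -/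
theorem IsTraceX.isWeakDeriv (hS : S.Admissible) {u w : ℝ × ℝ → ℝ} {c : ℝ} {h : ℝ → ℝ}
    (ht : S.IsTraceX u w c h) (hc : c ∈ Icc 0 S.l) (hu : Integrable u S.μ)
    (hw : Integrable w S.μ) : S.IsWeakDeriv (1, 0) u w := by
  refine isWeakDeriv_of_forall_add hu hw fun φ hφ hcs hs => ?_
  have hcd : Continuous fun q => fderiv ℝ φ q (1, 0) :=
    (hφ.continuous_fderiv (by simp)).clm_apply continuous_const
  have hint : Integrable (fun q => u q * fderiv ℝ φ q (1, 0) + w q * φ q) S.μ :=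
    (integrable_mul_of_hasCompactSupport hu hcd (hcs.fderiv_apply ℝ (1, 0))).add
    (integrable_mul_of_hasCompactSupport hw hφ.continuous hcs)
  have hz : ∀ q, q ∉ S.D → φ q = 0 := fun q hq =>
    image_eq_zero_of_notMem_tsupport fun hq' => hq (hs hq')
  rw [μ_eq_prod] at hint hw ⊢
  rw [IsTraceX, μ_eq_prod] at ht
  have ht' := Measure.ae_ae_of_ae_prod (Measure.measurePreserving_swap.quasiMeasurePreserving.ae ht)
  rw [integral_prod_symm _ hint, integral_eq_zero_of_ae]
  filter_upwards [ht', hw.prod_left_ae] with t ht hwt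
  have hder : ∀ x, HasDerivAt (fun x => φ (x, t)) (fderiv ℝ φ (x, t) (1, 0)) x := fun x =>
    ((hφ.differentiable (by simp)) (x, t)).hasFDerivAt.comp_hasDerivAt x
      ((hasDerivAt_id x).prodMk (hasDerivAt_const x t))
  have hpc : Continuous fun x => fderiv ℝ φ (x, t) (1, 0) := hcd.comp (by fun_prop)
  have hprim : ∀ x, ∫ y in (0 : ℝ)..x, fderiv ℝ φ (y, t) (1, 0) = φ (x, t) := fun x => by
    rw [intervalIntegral.integral_eq_sub_of_hasDerivAt (fun y _ => hder y)
      (hpc.intervalIntegrable _ _), hz (0, t) fun h0 => lt_irrefl _ h0.1.1, sub_zero]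
  have key := integral_primitive_mul_of_integral_eq_zero hS.l_pos hc
    (hpc.integrableOn_Icc.mono_set Ioo_subset_Icc_self) hwt
    (by rw [hprim, hz (S.l, t) fun h0 => lt_irrefl _ h0.1.2]) (h t)
  refine Eq.trans ?_ key
  refine integral_congr_ae ?_
  filter_upwards [ht] with x hx
  simp only [Prod.swap_prod_mk] at hx
  rw [hprim, ← hx]

theorem IsTraceT.isWeakDeriv (hS : S.Admissible) {u w : ℝ × ℝ → ℝ} {c : ℝ} {h : ℝ → ℝ}
    (ht : S.IsTraceT u w c h) (hc : c ∈ Icc 0 S.T) (hu : Integrable u S.μ)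
    (hw : Integrable w S.μ) : S.IsWeakDeriv (0, 1) u w := by
  refine isWeakDeriv_of_forall_add hu hw fun φ hφ hcs hs => ?_
  have hcd : Continuous fun q => fderiv ℝ φ q (0, 1) :=
    (hφ.continuous_fderiv (by simp)).clm_apply continuous_const
  have hint : Integrable (fun q => u q * fderiv ℝ φ q (0, 1) + w q * φ q) S.μ :=
    (integrable_mul_of_hasCompactSupport hu hcd (hcs.fderiv_apply ℝ (0, 1))).add
    (integrable_mul_of_hasCompactSupport hw hφ.continuous hcs)
  have hz : ∀ q, q ∉ S.D → φ q = 0 := fun q hq =>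
    image_eq_zero_of_notMem_tsupport fun hq' => hq (hs hq')
  rw [μ_eq_prod] at hint hw ⊢
  rw [IsTraceT, μ_eq_prod] at ht
  rw [integral_prod _ hint, integral_eq_zero_of_ae]
  filter_upwards [Measure.ae_ae_of_ae_prod ht, hw.prod_right_ae] with x hx hwx
  have hder : ∀ t, HasDerivAt (fun t => φ (x, t)) (fderiv ℝ φ (x, t) (0, 1)) t := fun t =>
    ((hφ.differentiable (by simp)) (x, t)).hasFDerivAt.comp_hasDerivAt t
      ((hasDerivAt_const t x).prodMk (hasDerivAt_id t))
  have hpc : Continuous fun t => fderiv ℝ φ (x, t) (0, 1) := hcd.comp (by fun_prop)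
  have hprim : ∀ t, ∫ s in (0 : ℝ)..t, fderiv ℝ φ (x, s) (0, 1) = φ (x, t) := fun t => by
    rw [intervalIntegral.integral_eq_sub_of_hasDerivAt (fun y _ => hder y)
      (hpc.intervalIntegrable _ _), hz (x, 0) fun h0 => lt_irrefl _ h0.2.1, sub_zero]
  have key := integral_primitive_mul_of_integral_eq_zero hS.T_pos hc
    (hpc.integrableOn_Icc.mono_set Ioo_subset_Icc_self) hwx
    (by rw [hprim, hz (x, S.T) fun h0 => lt_irrefl _ h0.2.2]) (h x)
  refine Eq.trans ?_ key
  refine integral_congr_ae ?_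
  filter_upwards [hx] with t ht'
  rw [hprim, ← ht']

theorem abs_primitive_le {η : ℝ → ℝ} {K : ℝ} (hη : ∀ t, |η t| ≤ K) :
    ∀ q ∈ S.D, |∫ s in S.T..q.2, η s| ≤ K * S.T := by
  rintro q ⟨-, hq⟩
  have h := intervalIntegral.norm_integral_le_of_norm_le_const (a := S.T) (b := q.2) (C := K)
    (f := η) fun s _ => hη s
  have hK : 0 ≤ K := (abs_nonneg _).trans (hη 0)
  refine h.trans (mul_le_mul_of_nonneg_left ?_ hK)
  rw [abs_le]
  constructor <;> linarith [hq.1, hq.2]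

theorem memLp_mul_of_bounded {a : ℝ → ℝ} (ha : Continuous a) (haC : ∀ x, |a x| ≤ 1) (r : ℝ)
    {b : ℝ → ℝ} (hb : Measurable b) {K : ℝ} (hK : ∀ q ∈ S.D, |b q.2| ≤ K) :
    MemLp (fun q : ℝ × ℝ => r * a q.1 * b q.2) 2 S.μ := by
  refine MemLp.of_bound (((measurable_const.mul (ha.measurable.comp measurable_fst)).mul
    (hb.comp measurable_snd)).aestronglyMeasurable) (|r| * K) ?_
  filter_upwards [S.ae_mem_D] with q hq
  rw [Real.norm_eq_abs, abs_mul, abs_mul]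
  have h := hK q hq
  have := (abs_nonneg _).trans h
  calc |r| * |a q.1| * |b q.2| ≤ |r| * 1 * K := by gcongr; exact haC _
    _ = |r| * K := by ring

/-- The very weak identity for the test functions `cos(nπx/l) θ(t)` with `θ(t) = ∫_T^t η`. -/
theorem VeryWeakIdentity.cos_mul (hS : S.Admissible) {B B₀ : ℝ → ℝ → ℝ → ℝ} {v : ℝ × ℝ → ℝ}
    (h : S.VeryWeakIdentity B B₀ v) (n : ℤ) {η : ℝ → ℝ} (hη : Measurable η) {K : ℝ}
    (hK : ∀ t, |η t| ≤ K) :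
    (∫ q in S.D, (B q.1 q.2 (v q) * (1 * Real.cos (n * Real.pi / S.l * q.1) * η q.2) +
        v q * (-(n * Real.pi / S.l) ^ 2 * Real.cos (n * Real.pi / S.l * q.1) *
          ∫ s in S.T..q.2, η s) +
        S.f q * (1 * Real.cos (n * Real.pi / S.l * q.1) * ∫ s in S.T..q.2, η s)))
      + (∫ x in Ioo 0 S.l, B₀ x 0 (S.Φ x) *
          (Real.cos (n * Real.pi / S.l * x) * ∫ s in S.T..0, η s))
      + (∫ t in Ioo 0 S.T, S.p t * (Real.cos (n * Real.pi / S.l * S.l) * ∫ s in S.T..t, η s))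
      - (∫ t in Ioo 0 S.T, S.g t * (Real.cos (n * Real.pi / S.l * 0) * ∫ s in S.T..t, η s)) = 0 := by
  set κ : ℝ := n * Real.pi / S.l with hκ
  have hηi : ∀ a b, IntervalIntegrable η volume a b := fun a b =>
    (intervalIntegrable_const (c := K)).mono_fun hη.aestronglyMeasurable
      (by filter_upwards with x; exact (hK x).trans (le_abs_self K))
  set θ : ℝ → ℝ := fun t => ∫ s in S.T..t, η s with hθ
  have hθc : Continuous θ := intervalIntegral.continuous_primitive hηi _
  have hθK : ∀ q ∈ S.D, |θ q.2| ≤ K * S.T := abs_primitive_le hK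
  have hcos : Continuous fun x => Real.cos (κ * x) := by fun_prop
  have hsin : Continuous fun x => Real.sin (κ * x) := by fun_prop
  have hdc : ∀ x, HasDerivAt (fun x => Real.cos (κ * x)) (-κ * Real.sin (κ * x)) x := fun x => by
    have := (Real.hasDerivAt_cos (κ * x)).comp x ((hasDerivAt_id x).const_mul κ)
    exact this.congr_deriv (by ring)
  have hds : ∀ x, HasDerivAt (fun x => -κ * Real.sin (κ * x)) (-κ ^ 2 * Real.cos (κ * x)) x :=
    fun x => by
      have := ((Real.hasDerivAt_sin (κ * x)).comp x ((hasDerivAt_id x).const_mul κ)).const_mul (-κ)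
      exact this.congr_deriv (by ring)
  -- This is where `κ = nπ/l` matters: `ψ_x` vanishes on `x = l` as well as on `x = 0`.
  have hsl : Real.sin (κ * S.l) = 0 := by
    rw [hκ, div_mul_cancel₀ _ hS.l_pos.ne']
    exact Real.sin_int_mul_pi n
  have hm := memLp_mul_of_bounded (S := S) hcos (fun x => Real.abs_cos_le_one _) 1 hθc.measurable hθK
  have hmt := memLp_mul_of_bounded (S := S) hcos (fun x => Real.abs_cos_le_one _) 1 hη
    (K := K) fun q _ => hK _
  have hmx := memLp_mul_of_bounded (S := S) hsin (fun x => Real.abs_sin_le_one _) (-κ)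
    hθc.measurable hθK
  have hmxx := memLp_mul_of_bounded (S := S) hcos (fun x => Real.abs_cos_le_one _) (-κ ^ 2)
    hθc.measurable hθK
  have htX : ∀ c, S.IsTraceX (fun q => 1 * Real.cos (κ * q.1) * θ q.2)
      (fun q => -κ * Real.sin (κ * q.1) * θ q.2) c (fun t => Real.cos (κ * c) * θ t) := by
    intro c
    filter_upwards with q
    rw [intervalIntegral.integral_mul_const, intervalIntegral.integral_eq_sub_of_hasDerivAt
      (fun x _ => hdc x) (Continuous.intervalIntegrable (by fun_prop) _ _)]
    ring
  have htXX : ∀ c, Real.sin (κ * c) = 0 → S.IsTraceX (fun q => -κ * Real.sin (κ * q.1) * θ q.2)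
      (fun q => -κ ^ 2 * Real.cos (κ * q.1) * θ q.2) c (fun _ => 0) := by
    intro c hc
    filter_upwards with q
    rw [intervalIntegral.integral_mul_const, intervalIntegral.integral_eq_sub_of_hasDerivAt
      (fun x _ => hds x) (Continuous.intervalIntegrable (by fun_prop) _ _), hc]
    ring
  -- `η` is only bounded and measurable, so `θ` need not be `C¹`; the representation by integrals is
  -- all that the trace requires.
  have htT : ∀ c, S.IsTraceT (fun q => 1 * Real.cos (κ * q.1) * θ q.2)
      (fun q => 1 * Real.cos (κ * q.1) * η q.2) c (fun x => Real.cos (κ * x) * θ c) := by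
    intro c
    filter_upwards with q
    have h1 : θ q.2 = θ c + ∫ s in c..q.2, η s :=
      (intervalIntegral.integral_add_adjacent_intervals (hηi _ _) (hηi _ _)).symm
    rw [intervalIntegral.integral_const_mul, h1]
    ring
  have htT0 : S.IsTraceT (fun q => 1 * Real.cos (κ * q.1) * θ q.2)
      (fun q => 1 * Real.cos (κ * q.1) * η q.2) S.T (fun _ => 0) := by
    have := htT S.T
    simpa only [hθ, intervalIntegral.integral_same, mul_zero] using this
  have hl0 : (0 : ℝ) ∈ Icc 0 S.l := ⟨le_rfl, hS.l_pos.le⟩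
  have i1 {w : ℝ × ℝ → ℝ} (hw : MemLp w 2 S.μ) : Integrable w S.μ := hw.integrable (by norm_num)
  exact h _ _ _ _ (fun x => Real.cos (κ * x) * θ 0) (fun t => Real.cos (κ * 0) * θ t)
    (fun t => Real.cos (κ * S.l) * θ t)
    { mem := hm
      mem_x := hmx
      mem_t := hmt
      deriv_x := (htX 0).isWeakDeriv hS hl0 (i1 hm) (i1 hmx)
      deriv_t := (htT 0).isWeakDeriv hS ⟨le_rfl, hS.T_pos.le⟩ (i1 hm) (i1 hmt)
      mem_xx := hmxx
      deriv_xx := (htXX 0 (by simp)).isWeakDeriv hS hl0 (i1 hmx) (i1 hmxx) }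
    htT0 (htXX 0 (by simp)) (htXX S.l hsl) (htT 0) (htX 0) (htX S.l)

/-! ### The energy inequality and uniqueness of very weak solutions -/

theorem integral_eq_intervalIntegral (hS : S.Admissible) {w : ℝ × ℝ → ℝ} (hw : Integrable w S.μ) :
    ∫ q, w q ∂S.μ = ∫ t in (0 : ℝ)..S.T, ∫ x in (0 : ℝ)..S.l, w (x, t) := by
  simp only [intervalIntegral.integral_of_le hS.T_pos.le, intervalIntegral.integral_of_le hS.l_pos.le,
    integral_Ioc_eq_integral_Ioo]
  rw [μ_eq_prod] at hw ⊢
  exact integral_prod_symm _ hw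

theorem integral_mul_cos_mul (hS : S.Admissible) {w : ℝ × ℝ → ℝ} (hw : Measurable w) {C : ℝ}
    (hC : ∀ q, |w q| ≤ C) (r : ℝ) (n : ℤ) {b : ℝ → ℝ} (hb : Measurable b) {K : ℝ}
    (hK : ∀ q ∈ S.D, |b q.2| ≤ K) :
    Integrable (fun q : ℝ × ℝ => w q * (r * Real.cos (n * Real.pi / S.l * q.1) * b q.2)) S.μ ∧
    ∫ q, w q * (r * Real.cos (n * Real.pi / S.l * q.1) * b q.2) ∂S.μ =
      r * ∫ t in (0 : ℝ)..S.T, (cosCoeff S.l n fun x => w (x, t)) * b t := by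
  have hm : MemLp w 2 S.μ := MemLp.of_bound hw.aestronglyMeasurable C (Eventually.of_forall hC)
  have hi := hm.integrable_mul (memLp_mul_of_bounded (S := S)
    (a := fun x => Real.cos (n * Real.pi / S.l * x)) (by fun_prop)
    (fun x => Real.abs_cos_le_one _) r hb hK)
  refine ⟨hi, (integral_eq_intervalIntegral hS hi).trans ?_⟩
  rw [← intervalIntegral.integral_const_mul]
  congr 1
  ext t
  rw [cosCoeff, ← intervalIntegral.integral_mul_const, ← intervalIntegral.integral_const_mul]
  congr 1
  ext x
  simp only [Pi.mul_apply]
  ring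

/-- The energy estimate, one cosine mode at a time. -/
theorem integral_mul_nonpos (hS : S.Admissible) {z e : ℝ × ℝ → ℝ} (hz : MemLp z ⊤ S.μ)
    (he : MemLp e ⊤ S.μ)
    (h : ∀ (n : ℤ) (η : ℝ → ℝ) (K : ℝ), Measurable η → (∀ t, |η t| ≤ K) →
      ∫ q, (z q * (1 * Real.cos (n * Real.pi / S.l * q.1) * η q.2) +
        e q * (-(n * Real.pi / S.l) ^ 2 * Real.cos (n * Real.pi / S.l * q.1) *
          ∫ s in S.T..q.2, η s)) ∂S.μ = 0) :
    ∫ q, z q * e q ∂S.μ ≤ 0 := by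
  obtain ⟨z', C₁, hzm, hzC, hzz⟩ := exists_measurable_bounded_ae_eq hz
  obtain ⟨e', C₂, hem, heC, hee⟩ := exists_measurable_bounded_ae_eq he
  have hint : Integrable (fun q => z' q * e' q) S.μ :=
    (MemLp.of_bound (p := 2) hzm.aestronglyMeasurable C₁ (Eventually.of_forall hzC)).integrable_mul
      (MemLp.of_bound (p := 2) hem.aestronglyMeasurable C₂ (Eventually.of_forall heC))
  have hcongr : ∫ q, z q * e q ∂S.μ = ∫ q, z' q * e' q ∂S.μ := by
    refine integral_congr_ae ?_
    filter_upwards [hzz, hee] with q h1 h2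
    rw [h1, h2]
  rw [hcongr, integral_eq_intervalIntegral hS hint]
  refine integral_integral_mul_nonpos_of_cosCoeff hS.l_pos hzm hem (C := max C₁ C₂)
    (fun q => (hzC q).trans (le_max_left _ _)) (fun q => (heC q).trans (le_max_right _ _))
    fun n => ?_
  -- The decisive choice of test function: with `θ' = η = e_n` the second term becomes a multiple of
  -- `∫ θ' θ`.
  set η : ℝ → ℝ := fun t => cosCoeff S.l n fun x => e' (x, t) with hη
  have hηm : Measurable η := measurable_cosCoeff hem n hS.l_pos.le
  have hηK : ∀ t, |η t| ≤ C₂ * S.l := fun t => abs_cosCoeff_le hS.l_pos.le (fun x => heC _) n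
  have hηi : ∀ a b, IntervalIntegrable η volume a b := fun a b =>
    (intervalIntegrable_const (c := C₂ * S.l)).mono_fun hηm.aestronglyMeasurable
      (by filter_upwards with x; exact (hηK x).trans (le_abs_self _))
  have hθm : Measurable fun t => ∫ s in S.T..t, η s :=
    (intervalIntegral.continuous_primitive hηi _).measurable
  obtain ⟨i1, h1⟩ := integral_mul_cos_mul hS hzm hzC 1 n hηm (fun q _ => hηK q.2)
  obtain ⟨i2, h2⟩ := integral_mul_cos_mul hS hem heC (-(n * Real.pi / S.l) ^ 2) n hθm
    (abs_primitive_le hηK)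
  have h3 := h n η _ hηm hηK
  have h4 : ∫ q, (z' q * (1 * Real.cos (n * Real.pi / S.l * q.1) * η q.2) +
      e' q * (-(n * Real.pi / S.l) ^ 2 * Real.cos (n * Real.pi / S.l * q.1) *
        ∫ s in S.T..q.2, η s)) ∂S.μ = 0 := by
    rw [← h3]
    refine integral_congr_ae ?_
    filter_upwards [hzz, hee] with q h1 h2
    rw [h1, h2]
  rw [integral_add i1 i2, h1, h2, one_mul] at h4
  -- `θ θ'` is the derivative of `θ² / 2`, and `θ(T) = 0` leaves only the value at `0`.
  have h5 : ∫ t in (0 : ℝ)..S.T, η t * ∫ s in S.T..t, η s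
      = -(∫ s in S.T..0, η s) ^ 2 / 2 := by
    have h6 := integral_mul_primitive_add (hηi 0 S.T) (hηi 0 S.T) (∫ s in S.T..0, η s)
      (∫ s in S.T..0, η s)
    simp only [intervalIntegral.integral_add_adjacent_intervals (hηi _ _) (hηi _ _),
      intervalIntegral.integral_same] at h6
    have h7 : ∀ t, η t * (∫ s in S.T..t, η s) + (∫ s in S.T..t, η s) * η t =
        2 * (η t * ∫ s in S.T..t, η s) := fun t => by ring
    simp only [h7, intervalIntegral.integral_const_mul] at h6
    linarith
  rw [h5] at h4
  have h8 : 0 ≤ (n * Real.pi / S.l) ^ 2 * (∫ s in S.T..0, η s) ^ 2 := by positivity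
  linarith

theorem IsTypeB.memLp (hS : S.Admissible) {B : ℝ → ℝ → ℝ → ℝ} (hB : S.IsTypeB B)
    {v : ℝ × ℝ → ℝ} (hv : MemLp v ⊤ S.μ) : MemLp (fun q => B q.1 q.2 (v q)) ⊤ S.μ := by
  obtain ⟨v', M, hvm, hvM, hvv⟩ := exists_measurable_bounded_ae_eq hv
  obtain ⟨C, hC⟩ := hB.exists_bound hS M
  have hm : Measurable fun q : ℝ × ℝ => B q.1 q.2 (v' q) :=
    hB.measurable.comp (measurable_fst.prodMk (measurable_snd.prodMk hvm))
  refine (MemLp.of_bound hm.aestronglyMeasurable C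
    (Eventually.of_forall fun q => hC _ _ _ (hvM q))).ae_eq ?_
  filter_upwards [hvv] with q hq
  rw [hq]

theorem IsTypeB.mul_sub_nonneg (hS : S.Admissible) {B B' : ℝ → ℝ → ℝ → ℝ} (hB : S.IsTypeB B)
    (hB' : S.IsTypeB B') (x t v w : ℝ) : 0 ≤ (B x t v - B' x t w) * (v - w) := by
  rcases lt_trichotomy v w with h | rfl | h
  · exact mul_nonneg_of_nonpos_of_nonpos (sub_nonpos.2 (hB.lt_of_lt hS hB' h x t x t).le)
      (sub_nonpos.2 h.le)
  · simp
  · exact mul_nonneg (sub_nonneg.2 (hB'.lt_of_lt hS hB h x t x t).le) (sub_nonneg.2 h.le)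

theorem IsTypeB.eq_of_mul_sub_eq_zero (hS : S.Admissible) {B B' : ℝ → ℝ → ℝ → ℝ}
    (hB : S.IsTypeB B) (hB' : S.IsTypeB B') {x t v w : ℝ}
    (h : (B x t v - B' x t w) * (v - w) = 0) : v = w := by
  rcases mul_eq_zero.1 h with h | h
  · rcases lt_trichotomy v w with h1 | h1 | h1
    · exact absurd (sub_eq_zero.1 h) (hB.lt_of_lt hS hB' h1 x t x t).ne
    · exact h1
    · exact absurd (sub_eq_zero.1 h) (hB'.lt_of_lt hS hB h1 x t x t).ne'
  · exact sub_eq_zero.1 h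

/-- `Φ` takes critical values only on a null set, and elsewhere both functions equal `b (Φ x)`. -/
theorem IsTypeB.initial_eq (hS : S.Admissible) {B B' : ℝ → ℝ → ℝ → ℝ} (hB : S.IsTypeB B)
    (hB' : S.IsTypeB B') (ψ : ℝ → ℝ) :
    ∫ x in Ioo 0 S.l, B x 0 (S.Φ x) * ψ x = ∫ x in Ioo 0 S.l, B' x 0 (S.Φ x) * ψ x := by
  refine integral_congr_ae ?_
  have h : ∀ᵐ x, ∀ j, ¬ (x ∈ Ioo 0 S.l ∧ S.Φ x = S.vcrit j) :=
    ae_all_iff.2 fun j => measure_eq_zero_iff_ae_notMem.1 (hS.Φ_null j)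
  filter_upwards [ae_restrict_mem measurableSet_Ioo, ae_restrict_of_ae h] with x hx hx'
  have hne : ∀ j, S.Φ x ≠ S.vcrit j := fun j hj => hx' j ⟨hx, hj⟩
  rw [hB.eq_b x 0 _ hne, hB'.eq_b x 0 _ hne]

theorem VeryWeakIdentity.ae_eq (hS : S.Admissible) {B B₀ B' B₀' : ℝ → ℝ → ℝ → ℝ}
    (hB : S.IsTypeB B) (hB₀ : S.IsTypeB B₀) (hB' : S.IsTypeB B') (hB₀' : S.IsTypeB B₀')
    {v w : ℝ × ℝ → ℝ} (hv : MemLp v ⊤ S.μ) (hw : MemLp w ⊤ S.μ) (hvi : S.VeryWeakIdentity B B₀ v)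
    (hwi : S.VeryWeakIdentity B' B₀' w) : v =ᵐ[S.μ] w := by
  have hBv := hB.memLp hS hv
  have hBw := hB'.memLp hS hw
  have hle := integral_mul_nonpos hS (hBv.sub hBw) (hv.sub hw) fun n η K hη hK => by
    have h1 := hvi.cos_mul hS n hη hK
    have h2 := hwi.cos_mul hS n hη hK
    rw [hB₀.initial_eq hS hB₀'] at h1
    have hηi : ∀ a b, IntervalIntegrable η volume a b := fun a b =>
      (intervalIntegrable_const (c := K)).mono_fun hη.aestronglyMeasurable
        (by filter_upwards with x; exact (hK x).trans (le_abs_self _))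
    have hθm : Measurable fun t => ∫ s in S.T..t, η s :=
      (intervalIntegral.continuous_primitive hηi _).measurable
    have hcos : Continuous fun x => Real.cos (n * Real.pi / S.l * x) := by fun_prop
    have m1 := memLp_mul_of_bounded (S := S) hcos (fun x => Real.abs_cos_le_one _) 1 hη
      (K := K) fun q _ => hK _
    have m2 := fun r => memLp_mul_of_bounded (S := S) hcos (fun x => Real.abs_cos_le_one _) r hθm
      (abs_primitive_le hK)
    have i {w ψ : ℝ × ℝ → ℝ} (hw : MemLp w ⊤ S.μ) (hψ : MemLp ψ 2 S.μ) :
        Integrable (fun q => w q * ψ q) S.μ := (hw.mono_exponent (p := 2) le_top).integrable_mul hψ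
    have hsum {z v : ℝ × ℝ → ℝ} (hz : MemLp z ⊤ S.μ) (hv : MemLp v ⊤ S.μ) :=
      ((i hz m1).add (i hv (m2 (-(n * Real.pi / S.l) ^ 2)))).add (i hS.f_mem (m2 1))
    have h3 := integral_sub (hsum hBv hv) (hsum hBw hw)
    refine Eq.trans ?_ (h3.trans ?_)
    · refine integral_congr_ae (Eventually.of_forall fun q => ?_)
      simp only [Pi.add_apply, Pi.sub_apply]
      ring
    · simp only [Pi.add_apply]
      change (∫ q in S.D, _) - (∫ q in S.D, _) = 0
      linarith
  have hnn : 0 ≤ᵐ[S.μ] fun q => (B q.1 q.2 (v q) - B' q.1 q.2 (w q)) * (v q - w q) :=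
    Eventually.of_forall fun q => hB.mul_sub_nonneg hS hB' _ _ _ _
  have hint : Integrable (fun q => (B q.1 q.2 (v q) - B' q.1 q.2 (w q)) * (v q - w q)) S.μ :=
    ((hBv.sub hBw).mono_exponent (p := 2) le_top).integrable_mul
      ((hv.sub hw).mono_exponent (p := 2) le_top)
  -- A nonnegative integrand with nonpositive integral vanishes almost everywhere.
  have hzero := (integral_eq_zero_iff_of_nonneg_ae hnn hint).1
    (le_antisymm hle (integral_nonneg_of_ae hnn))
  filter_upwards [hzero] with q hq
  exact hB.eq_of_mul_sub_eq_zero hS hB' hq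

end Data
-- The lemma of du Bois-Reymond and integration by parts in `x`
/-- An integrable function on a product whose integrals over all measurable rectangles vanish is
zero almost everywhere. -/
theorem ae_eq_zero_of_forall_setIntegral_prod_eq_zero {X Y : Type*} [MeasurableSpace X]
    [MeasurableSpace Y] {μ : Measure X} {ν : Measure Y} {K : X × Y → ℝ} (hK : Integrable K (μ.prod ν))
    (h : ∀ A C, MeasurableSet A → MeasurableSet C → ∫ q in A ×ˢ C, K q ∂(μ.prod ν) = 0) :
    K =ᵐ[μ.prod ν] 0 := by
  refine hK.ae_eq_zero_of_forall_setIntegral_eq_zero fun s hs hfin => ?_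
  -- Otherwise the induction over measurable sets would carry a finiteness condition.
  clear hfin
  have huniv : ∫ q, K q ∂(μ.prod ν) = 0 := by
    simpa using h univ univ MeasurableSet.univ MeasurableSet.univ
  induction s, hs using MeasurableSpace.induction_on_inter generateFrom_prod.symm
    isPiSystem_prod with
  | empty => simp
  | basic t ht =>
    obtain ⟨A, hA, C, hC, rfl⟩ := ht
    exact h A C hA hC
  | compl t ht ih => rw [setIntegral_compl ht hK, huniv, ih, sub_zero]
  | iUnion f hd hf ih =>
    rw [integral_iUnion hf hd hK.integrableOn]
    simp [ih]

/-- Products of smooth functions with compact support in the intervals `(0, l)` and `(0, T)` are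
enough to test whether a function vanishes almost everywhere. -/
theorem ae_eq_zero_of_forall_integral_mul_mul {l T : ℝ} {K : ℝ × ℝ → ℝ}
    (hK : Integrable K ((volume.restrict (Ioo 0 l)).prod (volume.restrict (Ioo 0 T))))
    (h : ∀ ρ θ : ℝ → ℝ, ContDiff ℝ ∞ ρ → HasCompactSupport ρ → tsupport ρ ⊆ Ioo 0 l →
      ContDiff ℝ ∞ θ → HasCompactSupport θ → tsupport θ ⊆ Ioo 0 T →
      ∫ q, K q * (ρ q.1 * θ q.2) ∂((volume.restrict (Ioo 0 l)).prod (volume.restrict (Ioo 0 T))) = 0) :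
    K =ᵐ[(volume.restrict (Ioo 0 l)).prod (volume.restrict (Ioo 0 T))] 0 := by
  have h1 : ∀ ρ : ℝ → ℝ, ContDiff ℝ ∞ ρ → HasCompactSupport ρ → tsupport ρ ⊆ Ioo 0 l →
      ∀ᵐ t ∂volume.restrict (Ioo 0 T), ∫ x in Ioo 0 l, K (x, t) * ρ x = 0 := by
    intro ρ hρ hρc hρs
    obtain ⟨C, hC⟩ := hρc.exists_bound_of_continuous hρ.continuous
    have hKρ := hK.mul_bdd (g := fun q : ℝ × ℝ => ρ q.1)
      (hρ.continuous.comp continuous_fst).aestronglyMeasurable (Eventually.of_forall fun q => hC q.1)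
    have hi := hKρ.integral_prod_right
    rw [ae_restrict_iff' measurableSet_Ioo]
    refine isOpen_Ioo.ae_eq_zero_of_integral_contDiff_smul_eq_zero
      (IntegrableOn.locallyIntegrableOn hi) fun θ hθ hθc hθs => ?_
    obtain ⟨C', hC'⟩ := hθc.exists_bound_of_continuous hθ.continuous
    have hKρθ := hKρ.mul_bdd (g := fun q : ℝ × ℝ => θ q.2)
      (hθ.continuous.comp continuous_snd).aestronglyMeasurable
      (Eventually.of_forall fun q => hC' q.2)
    have h2 := h ρ θ hρ hρc hρs hθ hθc hθs
    simp only [← mul_assoc] at h2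
    rw [integral_prod_symm _ hKρθ] at h2
    refine Eq.trans ?_ h2
    rw [← setIntegral_eq_integral_of_forall_compl_eq_zero (s := Ioo 0 T)]
    · refine integral_congr_ae (Eventually.of_forall fun t => ?_)
      simp only [smul_eq_mul]
      rw [integral_mul_const, mul_comm]
    · intro t ht
      rw [image_eq_zero_of_notMem_tsupport fun h' => ht (hθs h'), zero_smul]
  -- The null set of times in `h1` depends on `ρ`. Integrating over `C` before varying `ρ` makes
  -- this harmless.
  refine ae_eq_zero_of_forall_setIntegral_prod_eq_zero hK fun A C hA hC => ?_
  have hKC : Integrable K ((volume.restrict (Ioo 0 l)).prod ((volume.restrict (Ioo 0 T)).restrict C)) :=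
    hK.mono_measure (Measure.prod_mono le_rfl Measure.restrict_le_self)
  have h3 : ∀ᵐ x ∂volume.restrict (Ioo 0 l),
      ∫ t, K (x, t) ∂((volume.restrict (Ioo 0 T)).restrict C) = 0 := by
    rw [ae_restrict_iff' measurableSet_Ioo]
    refine isOpen_Ioo.ae_eq_zero_of_integral_contDiff_smul_eq_zero
      (IntegrableOn.locallyIntegrableOn hKC.integral_prod_left) fun ρ hρ hρc hρs => ?_
    obtain ⟨C', hC'⟩ := hρc.exists_bound_of_continuous hρ.continuous
    have hKρ := hKC.mul_bdd (g := fun q : ℝ × ℝ => ρ q.1)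
      (hρ.continuous.comp continuous_fst).aestronglyMeasurable
      (Eventually.of_forall fun q => hC' q.1)
    have h4 := integral_prod _ hKρ
    rw [integral_prod_symm _ hKρ, integral_eq_zero_of_ae (ae_restrict_of_ae (h1 ρ hρ hρc hρs))]
      at h4
    refine Eq.trans ?_ h4.symm
    rw [← setIntegral_eq_integral_of_forall_compl_eq_zero (s := Ioo 0 l)]
    · refine integral_congr_ae (Eventually.of_forall fun x => ?_)
      simp only [smul_eq_mul]
      rw [integral_mul_const, mul_comm]
    · intro x hx
      rw [image_eq_zero_of_notMem_tsupport fun h' => hx (hρs h'), zero_smul]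
  rw [setIntegral_prod _ hK.integrableOn]
  exact integral_eq_zero_of_ae (ae_restrict_of_ae h3)

theorem exists_contDiff_integral_eq_one {l : ℝ} (hl : 0 < l) : ∃ η : ℝ → ℝ, ContDiff ℝ ∞ η ∧
    HasCompactSupport η ∧ tsupport η ⊆ Ioo 0 l ∧ ∫ x, η x = 1 := by
  let f : ContDiffBump (l / 2) := ⟨l / 4, l / 3, by positivity, by linarith⟩
  refine ⟨f.normed volume, f.contDiff_normed, f.hasCompactSupport_normed, ?_, f.integral_normed⟩
  rw [f.tsupport_normed_eq, Real.closedBall_eq_Icc]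
  intro x hx
  have h1 : f.rOut = l / 3 := rfl
  rw [h1] at hx
  exact ⟨by linarith [hx.1], by linarith [hx.2]⟩

theorem integral_eq_setIntegral_of_tsupport_subset {ρ : ℝ → ℝ} {s : Set ℝ} (h : tsupport ρ ⊆ s) :
    ∫ x in s, ρ x = ∫ x, ρ x :=
  setIntegral_eq_integral_of_forall_compl_eq_zero fun _ hx =>
    image_eq_zero_of_notMem_tsupport fun h' => hx (h h')

/-- A smooth function with compact support in `(0, l)` and zero mean is the derivative of a smooth
function with compact support in `(0, l)`. -/
theorem exists_contDiff_hasDerivAt_of_integral_eq_zero {l : ℝ} (hl : 0 < l) {r : ℝ → ℝ}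
    (hr : ContDiff ℝ ∞ r) (hc : HasCompactSupport r) (hs : tsupport r ⊆ Ioo 0 l)
    (h0 : ∫ x, r x = 0) : ∃ χ : ℝ → ℝ, ContDiff ℝ ∞ χ ∧ HasCompactSupport χ ∧
      tsupport χ ⊆ Ioo 0 l ∧ ∀ x, HasDerivAt χ (r x) x := by
  obtain ⟨a, b, ha, hb, hab⟩ : ∃ a b, 0 < a ∧ b < l ∧ ∀ x, x ≤ a ∨ b ≤ x → r x = 0 := by
    rcases (tsupport r).eq_empty_or_nonempty with h | h
    -- For `r = 0` the witnesses make `Icc a b` empty.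
    · exact ⟨l, 0, hl, hl, fun x _ => image_eq_zero_of_notMem_tsupport (by simp [h])⟩
    · obtain ⟨a, ha, ha'⟩ := hc.isCompact.exists_isLeast h
      obtain ⟨b, hb, hb'⟩ := hc.isCompact.exists_isGreatest h
      refine ⟨a / 2, (b + l) / 2, by linarith [(hs ha).1], by linarith [(hs hb).2],
        fun x hx => image_eq_zero_of_notMem_tsupport fun hx' => ?_⟩
      rcases hx with hx | hx
      · linarith [ha' hx', (hs ha).1]
      · linarith [hb' hx', (hs hb).2]
  have hi : ∀ y z, IntervalIntegrable r volume y z := fun y z =>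
    hr.continuous.intervalIntegrable y z
  have hd : ∀ x, HasDerivAt (fun x => ∫ y in (0 : ℝ)..x, r y) (r x) x := fun x =>
    intervalIntegral.integral_hasDerivAt_right (hi 0 x)
      hr.continuous.stronglyMeasurable.stronglyMeasurableAtFilter hr.continuous.continuousAt
  have hzero : ∀ {y z : ℝ}, (∀ x ∈ uIcc y z, r x = 0) → ∫ x in y..z, r x = 0 := fun h => by
    rw [intervalIntegral.integral_congr (g := fun _ => 0) h, intervalIntegral.integral_zero]
  have hsub : Function.support (fun x => ∫ y in (0 : ℝ)..x, r y) ⊆ Icc a b := by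
    intro x hx
    by_contra hcon
    refine hx ?_
    rcases not_and_or.1 hcon with h | h
    · exact hzero fun y hy => hab y (Or.inl (hy.2.trans (max_le ha.le (not_le.1 h).le)))
    · change ∫ y in (0 : ℝ)..x, r y = 0
      rw [← intervalIntegral.integral_add_adjacent_intervals (hi 0 l) (hi l x),
        intervalIntegral.integral_of_le hl.le, integral_Ioc_eq_integral_Ioo,
        integral_eq_setIntegral_of_tsupport_subset hs, h0, zero_add]
      exact hzero fun y hy => hab y (Or.inr ((le_min hb.le (not_le.1 h).le).trans hy.1))
  refine ⟨fun x => ∫ y in (0 : ℝ)..x, r y, ?_,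
    HasCompactSupport.of_support_subset_isCompact isCompact_Icc hsub,
    (closure_minimal hsub isClosed_Icc).trans (Icc_subset_Ioo ha hb), hd⟩
  rw [contDiff_infty_iff_deriv]
  refine ⟨fun x => (hd x).differentiableAt, ?_⟩
  rwa [show deriv (fun x => ∫ y in (0 : ℝ)..x, r y) = r from funext fun x => (hd x).deriv]

/-- The moving upper limit is encoded by the indicator of `0 < y < x`, so that the integral runs
over a fixed space. -/
theorem stronglyMeasurable_primitive {w : ℝ × ℝ → ℝ} (hw : StronglyMeasurable w) :
    StronglyMeasurable fun q : ℝ × ℝ => ∫ y in Ioo 0 q.1, w (y, q.2) := by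
  have h : StronglyMeasurable fun p : (ℝ × ℝ) × ℝ =>
      {p : (ℝ × ℝ) × ℝ | p.2 ∈ Ioo 0 p.1.1}.indicator (fun p => w (p.2, p.1.2)) p := by
    refine (hw.comp_measurable (by fun_prop)).indicator ?_
    exact (measurableSet_lt measurable_const measurable_snd).inter
      (measurableSet_lt measurable_snd (measurable_fst.comp measurable_fst))
  have h2 := h.integral_prod_right' (ν := volume)
  convert h2 using 2 with q
  rw [← integral_indicator measurableSet_Ioo]
  rfl

namespace Data

variable {N : ℕ} {S : Data N}

theorem integrable_primitive {w : ℝ × ℝ → ℝ} (hw : StronglyMeasurable w)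
    (hi : Integrable w S.μ) : Integrable (fun q : ℝ × ℝ => ∫ y in Ioo 0 q.1, w (y, q.2)) S.μ := by
  have hg : Integrable (fun q : ℝ × ℝ => ∫ y in Ioo 0 S.l, ‖w (y, q.2)‖) S.μ := by
    rw [μ_eq_prod] at hi ⊢
    exact hi.norm.integral_prod_right.comp_snd _
  have hsec : ∀ᵐ q ∂S.μ, IntegrableOn (fun y => w (y, q.2)) (Ioo 0 S.l) := by
    rw [μ_eq_prod] at hi ⊢
    exact Measure.quasiMeasurePreserving_snd.ae hi.prod_left_ae
  refine hg.mono' (stronglyMeasurable_primitive hw).aestronglyMeasurable ?_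
  filter_upwards [S.ae_mem_D, hsec] with q hq hs
  exact (norm_integral_le_integral_norm _).trans (setIntegral_mono_set hs.norm
    (Eventually.of_forall fun _ => norm_nonneg _)
    (Ioo_subset_Ioo_right hq.1.2.le).eventuallyLE)

theorem isTraceX_congr_right {u w w' : ℝ × ℝ → ℝ} {h : ℝ → ℝ} (hww : w =ᵐ[S.μ] w')
    (ht : S.IsTraceX u w' 0 h) : S.IsTraceX u w 0 h := by
  have hsec : ∀ᵐ q ∂S.μ, ∀ᵐ y ∂volume.restrict (Ioo 0 S.l), w (y, q.2) = w' (y, q.2) := by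
    rw [μ_eq_prod] at hww ⊢
    exact Measure.quasiMeasurePreserving_snd.ae
      (Measure.ae_ae_of_ae_prod (Measure.measurePreserving_swap.quasiMeasurePreserving.ae hww))
  filter_upwards [ht, hsec, S.ae_mem_D] with q hq hs hD
  rw [hq, intervalIntegral.integral_of_le hD.1.1.le, intervalIntegral.integral_of_le hD.1.1.le]
  congr 1
  rw [integral_Ioc_eq_integral_Ioo, integral_Ioc_eq_integral_Ioo]
  exact integral_congr_ae (ae_restrict_of_ae_restrict_of_subset
    (Ioo_subset_Ioo_right hD.1.2.le) (hs.mono fun _ h => h.symm))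

theorem fderiv_mul_apply_one_zero {χ θ χ' : ℝ → ℝ} (hχ : ∀ x, HasDerivAt χ (χ' x) x)
    (hθ : Differentiable ℝ θ) (q : ℝ × ℝ) :
    fderiv ℝ (fun q : ℝ × ℝ => χ q.1 * θ q.2) q (1, 0) = χ' q.1 * θ q.2 := by
  have h1 : HasFDerivAt (fun q : ℝ × ℝ => χ q.1) _ q :=
    (hχ q.1).hasFDerivAt.comp q hasFDerivAt_fst
  have h2 : HasFDerivAt (fun q : ℝ × ℝ => θ q.2) _ q :=
    (hθ q.2).hasFDerivAt.comp q hasFDerivAt_snd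
  have h3 := (h1.mul h2).fderiv
  change fderiv ℝ (fun q : ℝ × ℝ => χ q.1 * θ q.2) q = _ at h3
  rw [h3]
  simp [mul_comm]

/-- The lemma of du Bois-Reymond: a function whose weak `x`-derivative vanishes depends on `t`
only. -/
theorem IsWeakDeriv.exists_ae_eq_of_zero (hS : S.Admissible) {u : ℝ × ℝ → ℝ} (hu : Integrable u S.μ)
    (h : S.IsWeakDeriv (1, 0) u 0) : ∃ c : ℝ → ℝ, ∀ᵐ q ∂S.μ, u q = c q.2 := by
  obtain ⟨η, hη, hηc, hηs, hη1⟩ := exists_contDiff_integral_eq_one hS.l_pos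
  -- A function of `t` alone equals its own average against a weight `η` of mass one.
  refine ⟨fun t => ∫ x in Ioo 0 S.l, u (x, t) * η x, ?_⟩
  have hbdd : ∀ {w : ℝ × ℝ → ℝ} {ρ : ℝ → ℝ}, Integrable w S.μ → ContDiff ℝ ∞ ρ →
      HasCompactSupport ρ → Integrable (fun q => w q * ρ q.1) S.μ := by
    intro w ρ hw hρ hρc
    obtain ⟨C, hC⟩ := hρc.exists_bound_of_continuous hρ.continuous
    exact hw.mul_bdd (hρ.continuous.comp continuous_fst).aestronglyMeasurable
      (Eventually.of_forall fun q => hC q.1)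
  have hbddt : ∀ {w : ℝ × ℝ → ℝ} {ρ : ℝ → ℝ}, Integrable w S.μ → ContDiff ℝ ∞ ρ →
      HasCompactSupport ρ → Integrable (fun q => w q * ρ q.2) S.μ := by
    intro w ρ hw hρ hρc
    obtain ⟨C, hC⟩ := hρc.exists_bound_of_continuous hρ.continuous
    exact hw.mul_bdd (hρ.continuous.comp continuous_snd).aestronglyMeasurable
      (Eventually.of_forall fun q => hC q.2)
  have huη := hbdd hu hη hηc
  have hci : Integrable (fun q : ℝ × ℝ => ∫ x in Ioo 0 S.l, u (x, q.2) * η x) S.μ := by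
    rw [μ_eq_prod] at huη ⊢
    exact huη.integral_prod_right.comp_snd _
  have hK := hu.sub hci
  suffices hz : (u - fun q : ℝ × ℝ => ∫ x in Ioo 0 S.l, u (x, q.2) * η x) =ᵐ[S.μ] 0 by
    filter_upwards [hz] with q hq
    exact sub_eq_zero.1 hq
  have hμ := μ_eq_prod S
  rw [hμ]
  refine ae_eq_zero_of_forall_integral_mul_mul (hμ ▸ hK) fun ρ θ hρ hρc hρs hθ hθc hθs => ?_
  rw [← hμ]
  set m := ∫ x, ρ x with hm
  have hρi : Integrable ρ := hρ.continuous.integrable_of_hasCompactSupport hρc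
  have hηi : Integrable η := hη.continuous.integrable_of_hasCompactSupport hηc
  have hrs : tsupport (fun x => ρ x - m * η x) ⊆ Ioo 0 S.l :=
    (tsupport_sub ρ fun x => m * η x).trans (union_subset hρs
      ((tsupport_mul_subset_right (f := fun _ => m)).trans hηs))
  -- Subtracting `m η` removes the mean of `ρ`, so the remainder is `χ'` and `χ(x) θ(t)` is an
  -- admissible test function.
  obtain ⟨χ, hχ, hχc, hχs, hχd⟩ := exists_contDiff_hasDerivAt_of_integral_eq_zero hS.l_pos
    (r := fun x => ρ x - m * η x) (hρ.sub (contDiff_const.mul hη)) (hρc.sub hηc.mul_left) hrs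
    (by rw [integral_sub hρi (hηi.const_mul m), integral_const_mul, hη1, mul_one, sub_self])
  have hsupp : Function.support (fun q : ℝ × ℝ => χ q.1 * θ q.2) ⊆ tsupport χ ×ˢ tsupport θ := by
    intro q hq
    exact ⟨subset_tsupport _ (left_ne_zero_of_mul hq), subset_tsupport _ (right_ne_zero_of_mul hq)⟩
  have hkey := h (fun q => χ q.1 * θ q.2) (by fun_prop)
    (HasCompactSupport.of_support_subset_isCompact (hχc.isCompact.prod hθc.isCompact) hsupp)
    ((closure_minimal hsupp ((isClosed_tsupport _).prod (isClosed_tsupport _))).trans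
      (prod_mono hχs hθs))
  simp only [Pi.zero_apply, zero_mul, integral_zero, neg_zero,
    fderiv_mul_apply_one_zero hχd (hθ.differentiable (by simp))] at hkey
  change ∫ q, _ ∂S.μ = 0 at hkey
  have e1 : ∫ q : ℝ × ℝ, (∫ x in Ioo 0 S.l, u (x, q.2) * η x) * ρ q.1 * θ q.2 ∂S.μ =
      ∫ q, m * (u q * η q.1 * θ q.2) ∂S.μ := by
    have j1 := hbddt (hbdd hci hρ hρc) hθ hθc
    have j2 := (hbddt huη hθ hθc).const_mul m
    rw [hμ] at j1 j2 ⊢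
    rw [integral_prod_symm _ j1, integral_prod_symm _ j2]
    congr 1
    ext t
    simp only [integral_const_mul, integral_mul_const]
    rw [integral_eq_setIntegral_of_tsupport_subset hρs]
    ring
  have e2 : ∫ q : ℝ × ℝ, u q * ((ρ q.1 - m * η q.1) * θ q.2) ∂S.μ =
      ∫ q, (u q * ρ q.1 * θ q.2 - m * (u q * η q.1 * θ q.2)) ∂S.μ := by
    congr 1
    ext q
    ring
  rw [e2, integral_sub (hbddt (hbdd hu hρ hρc) hθ hθc) ((hbddt huη hθ hθc).const_mul m), ← e1,
    ← integral_sub (hbddt (hbdd hu hρ hρc) hθ hθc) (hbddt (hbdd hci hρ hρc) hθ hθc)] at hkey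
  refine Eq.trans ?_ hkey
  congr 1
  ext q
  simp only [Pi.sub_apply]
  ring

/-- Subtracting the primitive of a strongly measurable version of `w` leaves zero weak
`x`-derivative, hence a function of `t` alone, which is the trace. -/
theorem IsWeakDeriv.exists_isTraceX (hS : S.Admissible) {u w : ℝ × ℝ → ℝ} (hu : Integrable u S.μ)
    (hw : Integrable w S.μ) (h : S.IsWeakDeriv (1, 0) u w) : ∃ c : ℝ → ℝ, S.IsTraceX u w 0 c := by
  obtain ⟨w', hw', hww⟩ := hw.aestronglyMeasurable
  have hwi : Integrable w' S.μ := hw.congr hww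
  have hP := integrable_primitive hw' hwi
  have hPt : S.IsTraceX (fun q : ℝ × ℝ => ∫ y in Ioo 0 q.1, w' (y, q.2)) w' 0 fun _ => 0 := by
    filter_upwards [S.ae_mem_D] with q hq
    rw [zero_add, intervalIntegral.integral_of_le hq.1.1.le, integral_Ioc_eq_integral_Ioo]
  have hPd := hPt.isWeakDeriv hS ⟨le_rfl, hS.l_pos.le⟩ hP hwi
  have h0 : S.IsWeakDeriv (1, 0) (fun q => u q - ∫ y in Ioo 0 q.1, w' (y, q.2)) 0 := by
    intro φ hφ hc hs
    have hcd : Continuous fun q => fderiv ℝ φ q (1, 0) :=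
      (hφ.continuous_fderiv (by simp)).clm_apply continuous_const
    have hcc : HasCompactSupport fun q => fderiv ℝ φ q (1, 0) := hc.fderiv_apply ℝ (1, 0)
    have e := integral_sub (integrable_mul_of_hasCompactSupport hu hcd hcc)
      (integrable_mul_of_hasCompactSupport hP hcd hcc)
    have e1 := h φ hφ hc hs
    have e2 := hPd φ hφ hc hs
    have e3 : ∫ q in S.D, w q * φ q = ∫ q in S.D, w' q * φ q := by
      refine integral_congr_ae ?_
      change ∀ᵐ q ∂S.μ, _
      filter_upwards [hww] with q hq
      rw [hq]
    simp only [sub_mul, Pi.zero_apply, zero_mul, integral_zero, neg_zero]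
    refine e.trans ?_
    change (∫ q in S.D, _) - (∫ q in S.D, _) = 0
    rw [e1, e2, e3, sub_self]
  obtain ⟨c, hc⟩ := h0.exists_ae_eq_of_zero hS (hu.sub hP)
  refine ⟨c, isTraceX_congr_right hww ?_⟩
  filter_upwards [hc, hPt] with q hq hq'
  rw [zero_add] at hq'
  rw [← hq', ← hq, Pi.sub_apply, sub_add_cancel]

/-- Integration by parts in `x` against a function with vanishing traces on `x = 0` and `x = l`. -/
theorem integral_mul_add_mul_eq_zero (hS : S.Admissible) {v vx w wx : ℝ × ℝ → ℝ}
    (hv : MemLp v 2 S.μ) (hvx : MemLp vx 2 S.μ) (hw : MemLp w 2 S.μ) (hwx : MemLp wx 2 S.μ)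
    (hd : S.IsWeakDeriv (1, 0) v vx) (h0 : S.IsTraceX w wx 0 fun _ => 0)
    (hl : S.IsTraceX w wx S.l fun _ => 0) : ∫ q, (v q * wx q + vx q * w q) ∂S.μ = 0 := by
  have hvxi := hvx.integrable (by norm_num)
  have hwxi := hwx.integrable (by norm_num)
  obtain ⟨c, hc⟩ := hd.exists_isTraceX hS (hv.integrable (by norm_num)) hvxi
  have hint : Integrable (fun q => v q * wx q + vx q * w q) S.μ :=
    (hv.integrable_mul hwx).add (hvx.integrable_mul hw)
  have hall := hc.and (h0.and hl)
  rw [μ_eq_prod] at hint hvxi hwxi hall ⊢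
  have hall' := Measure.ae_ae_of_ae_prod
    (Measure.measurePreserving_swap.quasiMeasurePreserving.ae hall)
  rw [integral_prod_symm _ hint]
  refine integral_eq_zero_of_ae ?_
  filter_upwards [hall', hvxi.prod_left_ae, hwxi.prod_left_ae] with t ht hvt hwt
  simp only [Prod.swap_prod_mk, zero_add] at ht
  have hwt' : IntervalIntegrable (fun x => wx (x, t)) volume 0 S.l :=
    (intervalIntegrable_iff_integrableOn_Ioo_of_le hS.l_pos.le).2 hwt
  have hne : NeBot (ae (volume.restrict (Ioo 0 S.l))) := by
    rw [ae_neBot, Ne, Measure.restrict_eq_zero, Real.volume_Ioo]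
    simpa using hS.l_pos
  -- One `x` at which both trace formulas hold is enough: the integrals of `wx` from `0` and from
  -- `l` to `x` agree.
  have hzero : ∫ x in (0 : ℝ)..S.l, wx (x, t) = 0 := by
    obtain ⟨x, ⟨-, hx0, hxl⟩, hx⟩ := (ht.and (ae_restrict_mem measurableSet_Ioo)).exists
    have hsub : ∀ {a b : ℝ}, a ∈ Icc 0 S.l → b ∈ Icc 0 S.l →
        IntervalIntegrable (fun x => wx (x, t)) volume a b := fun ha hb => hwt'.mono_set (by
      rw [uIcc_of_le hS.l_pos.le]
      exact (convex_Icc 0 S.l).ordConnected.uIcc_subset ha hb)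
    have hx' := Ioo_subset_Icc_self hx
    rw [← intervalIntegral.integral_add_adjacent_intervals
      (hsub ⟨le_rfl, hS.l_pos.le⟩ hx') (hsub hx' ⟨hS.l_pos.le, le_rfl⟩), ← hx0, hxl,
      intervalIntegral.integral_add_adjacent_intervals (hsub ⟨hS.l_pos.le, le_rfl⟩ hx')
      (hsub hx' ⟨hS.l_pos.le, le_rfl⟩), intervalIntegral.integral_same]
  refine Eq.trans ?_ (integral_primitive_mul_of_integral_eq_zero hS.l_pos ⟨le_rfl, hS.l_pos.le⟩
    hwt hvt hzero (c t))
  refine integral_congr_ae ?_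
  filter_upwards [ht] with x hx
  rw [← hx.1, ← hx.2.1]

/-! ### From weak to very weak solutions, and the main theorem -/

/-- Test functions of (2) are admissible in (1). Since `ψ_x` has zero traces, `∫∫ v_x ψ_x = -∫∫ v
ψ_xx`, and (2) is (1) with the sign reversed. -/
theorem WeakIdentity.veryWeakIdentity (hS : S.Admissible) {B B₀ : ℝ → ℝ → ℝ → ℝ}
    (hB : S.IsTypeB B) {v vx vt : ℝ × ℝ → ℝ} (hv : MemLp v ⊤ S.μ) (hv1 : S.IsW11 v vx vt)
    (h : S.WeakIdentity B B₀ v vx) : S.VeryWeakIdentity B B₀ v := by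
  intro ψ ψx ψxx ψt ψ₀ ψl ψr hψ hT hx0 hxl h0 hl hr
  have h1 := h ψ ψx ψt ψ₀ ψl ψr hψ.toIsW11 hT h0 hl hr
  have h2 := integral_mul_add_mul_eq_zero hS hv1.mem hv1.mem_x hψ.mem_x hψ.mem_xx hv1.deriv_x
    hx0 hxl
  have i1 : Integrable (fun q => B q.1 q.2 (v q) * ψt q) S.μ :=
    ((hB.memLp hS hv).mono_exponent (p := 2) le_top).integrable_mul hψ.mem_t
  have i2 : Integrable (fun q => v q * ψxx q) S.μ := hv1.mem.integrable_mul hψ.mem_xx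
  have i3 : Integrable (fun q => vx q * ψx q) S.μ := hv1.mem_x.integrable_mul hψ.mem_x
  have i4 : Integrable (fun q => S.f q * ψ q) S.μ :=
    (hS.f_mem.mono_exponent (p := 2) le_top).integrable_mul hψ.mem
  have i12 : Integrable (fun q => B q.1 q.2 (v q) * ψt q + v q * ψxx q) S.μ := i1.add i2
  have i13 : Integrable (fun q => -(B q.1 q.2 (v q) * ψt q) + vx q * ψx q) S.μ := i1.neg.add i3
  have i1' : Integrable (fun q => -(B q.1 q.2 (v q) * ψt q)) S.μ := i1.neg
  have e1 : ∫ q in S.D, (-(B q.1 q.2 (v q)) * ψt q + vx q * ψx q - S.f q * ψ q) =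
      -(∫ q, B q.1 q.2 (v q) * ψt q ∂S.μ) + (∫ q, vx q * ψx q ∂S.μ) - ∫ q, S.f q * ψ q ∂S.μ := by
    simp only [neg_mul]
    rw [← integral_neg, ← integral_add i1' i3, ← integral_sub i13 i4]
    rfl
  have e2 : ∫ q in S.D, (B q.1 q.2 (v q) * ψt q + v q * ψxx q + S.f q * ψ q) =
      (∫ q, B q.1 q.2 (v q) * ψt q ∂S.μ) + (∫ q, v q * ψxx q ∂S.μ) + ∫ q, S.f q * ψ q ∂S.μ := by
    rw [← integral_add i1 i2, ← integral_add i12 i4]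
    rfl
  rw [integral_add i2 i3] at h2
  rw [e1] at h1
  rw [e2]
  linarith

end Data

end Stefan

theorem mainTheorem6 {N : ℕ} (S : Stefan.Data N) (hS : S.Admissible) :
    -- there is at most one weak solution
    (∀ v w : ℝ × ℝ → ℝ, S.IsWeakSolution v → S.IsWeakSolution w → v =ᵐ[S.μ] w) ∧
    -- there is at most one very weak solution
    (∀ v w : ℝ × ℝ → ℝ, S.IsVeryWeakSolution v → S.IsVeryWeakSolution w → v =ᵐ[S.μ] w) ∧
    -- every weak solution is a very weak solution
    (∀ v : ℝ × ℝ → ℝ, S.IsWeakSolution v → S.IsVeryWeakSolution v) ∧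
    -- the same for functions that satisfy the identities with just one pair of type `𝓑`, each
    -- with its own pair
    (∀ B B₀ : ℝ → ℝ → ℝ → ℝ, S.IsTypeB B → S.IsTypeB B₀ → ∀ v : ℝ × ℝ → ℝ,
      S.IsWeakSolutionWith B B₀ v → S.IsVeryWeakSolutionWith B B₀ v) ∧
    (∀ B B₀ B' B₀' : ℝ → ℝ → ℝ → ℝ, S.IsTypeB B → S.IsTypeB B₀ → S.IsTypeB B' → S.IsTypeB B₀' →
      ∀ v w : ℝ × ℝ → ℝ, S.IsVeryWeakSolutionWith B B₀ v → S.IsVeryWeakSolutionWith B' B₀' w →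
        v =ᵐ[S.μ] w) ∧
    (∀ B B₀ B' B₀' : ℝ → ℝ → ℝ → ℝ, S.IsTypeB B → S.IsTypeB B₀ → S.IsTypeB B' → S.IsTypeB B₀' →
      ∀ v w : ℝ × ℝ → ℝ, S.IsWeakSolutionWith B B₀ v → S.IsWeakSolutionWith B' B₀' w →
        v =ᵐ[S.μ] w) := by
  obtain ⟨B₁, hB₁⟩ := hS.exists_isTypeB
  have vw : ∀ B B₀ B' B₀' : ℝ → ℝ → ℝ → ℝ, S.IsTypeB B → S.IsTypeB B₀ → S.IsTypeB B' →
      S.IsTypeB B₀' → ∀ v w : ℝ × ℝ → ℝ, S.IsVeryWeakSolutionWith B B₀ v →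
      S.IsVeryWeakSolutionWith B' B₀' w → v =ᵐ[S.μ] w :=
    fun B B₀ B' B₀' hB hB₀ hB' hB₀' v w hv hw =>
      Stefan.Data.VeryWeakIdentity.ae_eq hS hB hB₀ hB' hB₀' hv.1 hw.1 hv.2 hw.2
  have inc : ∀ B B₀ : ℝ → ℝ → ℝ → ℝ, S.IsTypeB B → S.IsTypeB B₀ → ∀ v : ℝ × ℝ → ℝ,
      S.IsWeakSolutionWith B B₀ v → S.IsVeryWeakSolutionWith B B₀ v := by
    rintro B B₀ hB - v ⟨hv, vx, vt, h1, h2⟩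
    exact ⟨hv, h2.veryWeakIdentity hS hB hv h1⟩
  have incAll : ∀ v : ℝ × ℝ → ℝ, S.IsWeakSolution v → S.IsVeryWeakSolution v := by
    rintro v ⟨hv, vx, vt, h1, h2⟩
    exact ⟨hv, fun B B₀ hB hB₀ => (h2 B B₀ hB hB₀).veryWeakIdentity hS hB hv h1⟩
  have vwAll : ∀ v w : ℝ × ℝ → ℝ, S.IsVeryWeakSolution v → S.IsVeryWeakSolution w → v =ᵐ[S.μ] w :=
    fun v w hv hw => vw B₁ B₁ B₁ B₁ hB₁ hB₁ hB₁ hB₁ v w ⟨hv.1, hv.2 _ _ hB₁ hB₁⟩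
      ⟨hw.1, hw.2 _ _ hB₁ hB₁⟩
  exact ⟨fun v w hv hw => vwAll v w (incAll v hv) (incAll w hw), vwAll, incAll, inc, vw,
    fun B B₀ B' B₀' hB hB₀ hB' hB₀' v w hv hw => vw B B₀ B' B₀' hB hB₀ hB' hB₀' v w
      (inc B B₀ hB hB₀ v hv) (inc B' B₀' hB' hB₀' w hw)⟩
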